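/- **Setting.** Let $\mathfrak g$ be a simple complex Lie algebra, $\mathfrak h$ a Cartan subalgebra with root system $\Phi$, and let $\alpha_1,\dots,\alpha_N$ be simple roots of one of the following types, with the indicated symmetry $\tau$ of the Dynkin diagram: * $\mathfrak g=\mathfrak{so}_{2n+2}(\mathbb C)$, $n\ge 2$, $m=2$, $\tau:\alpha_n\leftrightarrow\alpha_{n+1}$ (the other $\alpha_k$ fixed), where $\alpha_k=\epsilon_k-\epsilon_{k+1}$ for $k\le n$ and $\alpha_{n+1}=\epsilon_n+\epsilon_{n+1}$; * $\mathfrak g=\mathfrak{sl}_{2n}(\mathbb C)$, $n\ge 2$, $m=2$, $\tau:\alpha_k\leftrightarrow\alpha_{2n-k}$, where $\alpha_k=\epsilon_k-\epsilon_{k+1}$; * $\mathfrak g=E_6$, $m=2$, $\tau:\alpha_k\leftrightarrow\alpha_{6-k}$ for $k\le 5$ and $\alpha_6\mapsto\alpha_6$, where $\alpha_k=\epsilon_k-\epsilon_{k+1}$ ($k\le5$) form a chain and $\alpha_6$ is joined to $\alpha_3$; * $\mathfrak g=\mathfrak{so}_8(\mathbb C)$, $m=3$, $\tau:\alpha_1\mapsto\alpha_3\mapsto\alpha_4\mapsto\alpha_1$,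 $\alpha_2\mapsto\alpha_2$, with $\alpha_k$ as for $\mathfrak{so}_{2n+2}(\mathbb C)$, $n=3$. Normalize the invariant form so that all roots have squared length $2$ and identify $\mathfrak h$ with $\mathfrak h^*$ through it. Let $e_\alpha\in\mathfrak g_\alpha$ ($\alpha\in\Phi$) be root vectors with $[e_\alpha,e_{-\alpha}]=-\alpha$ and $[e_\alpha,e_\beta]=\pm e_{\alpha+\beta}$ whenever $\alpha+\beta\in\Phi$, and let $\theta$ be the diagram automorphism: an automorphism of $\mathfrak g$ preserving $\mathfrak h$ such that, for the action $\theta\cdot\alpha=\alpha\circ\theta^{-1}$, one has $\theta\cdot\alpha_k=\tau(\alpha_k)$ for all $k$ and $\theta(e_\alpha)=e_{\theta\cdot\alpha}$ for all $\alpha\in\Phi$. Let $\omega$ be a primitive $m$-th root of unity, $\mathfrak g_j=\{x\mid\theta(x)=\omega^jx\}$ and $\mathfrak c=\mathfrak h\cap\mathfrak g_1$, with inclusion $\rho:\mathfrak c\to\mathfrak h$. Let $G$ be any connected semisimple complex algebraic group with Lie algebra $\mathfrak g$, $G_0\subset G$ the connected subgroup with Lie algebra $\mathfrak g_0$, and $W=N_{G_0}(\mathfrak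 c)/Z_{G_0}(\mathfrak c)\subset GL(\mathfrak c)$ the little Weyl group. Let $\Sigma=\{\beta\circ\rho\mid\beta\in\Phi\}\setminus\{0\}$ be the set of restricted roots, $\Pi_\sigma=\ker\sigma\subset\mathfrak c$ for $\sigma\in\Sigma$, and put $$e_\alpha^{(0)}=\frac{|\mathcal O_\alpha|}{m}\sum_{i=0}^{m-1}\theta^i(e_\alpha)\in\mathfrak g_0,\qquad \mathcal O_\alpha=\{\theta^i\cdot\alpha\mid 0\le i\le m-1\}.$$ A reflection is an $s\in GL(\mathfrak c)$ of finite order with $\dim\Pi_s=\dim\mathfrak c-1$, where $\Pi_s=\ker(s-\mathrm{id}_{\mathfrak c})$. Consider the following table of roots $\alpha$: | $\mathfrak g$ | $m$ | $\alpha$ | |---|---|---| | $\mathfrak{so}_{2n+2}(\mathbb C)$ | 2 | $\alpha_{n+1}=\epsilon_n+\epsilon_{n+1}$ | | $\mathfrak{sl}_{2n}(\mathbb C)$ | 2 | $\alpha_i+\cdots+\alpha_{j-1}=\epsilon_i-\epsilon_j$, $1\le i<j\le 2n$, $j\ne 2n+1-i$ | | $E_6$ | 2 | $\alpha_i+\cdots+\alpha_{j-1}=\epsilon_i-\epsilon_j$,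 $1\le i<j\le 6$, $j\ne 7-i$ | | $\mathfrak{so}_8(\mathbb C)$ | 3 | $\alpha_1=\epsilon_1-\epsilon_2$ | **Theorem.** The space $\mathfrak c$ is a Cartan subspace, i.e. a maximal abelian subspace of $\mathfrak g_1$ consisting of semisimple elements. For every $\sigma\in\Sigma$ there is a root $\alpha$ in the table with $\ker(\alpha\circ\rho)=\Pi_\sigma$, and for every such $\alpha$ the element $$\exp\Big(\tfrac{\pi}{2}\big(e_\alpha^{(0)}+e_{-\alpha}^{(0)}\big)\Big)\in G_0$$ normalizes $\mathfrak c$ and induces on it a reflection $s\in W$ with $\Pi_s=\Pi_\sigma$. -/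

import Mathlib

noncomputable section

namespace ThetaGroup

open LieAlgebra LieAlgebra.IsKilling

/-! ### Exponentials and subgroups of `GL(V)` -/

/-- The exponential `∑ f ^ n / n!` of an endomorphism of a finite-dimensional complex vector space,
computed through its matrix in a basis (the result does not depend on the basis). -/
def expEnd {V : Type*} [AddCommGroup V] [Module ℂ V] [FiniteDimensional ℂ V]
    (f : Module.End ℂ V) : Module.End ℂ V :=
  (LinearMap.toMatrixAlgEquiv (Module.finBasis ℂ V)).symm
    (NormedSpace.exp (LinearMap.toMatrixAlgEquiv (Module.finBasis ℂ V) f))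

theorem expEnd_mul_neg {V : Type*} [AddCommGroup V] [Module ℂ V] [FiniteDimensional ℂ V]
    (f : Module.End ℂ V) : expEnd f * expEnd (-f) = 1 := by
  unfold expEnd
  have h : ∀ A : Matrix (Fin (Module.finrank ℂ V)) (Fin (Module.finrank ℂ V)) ℂ,
      NormedSpace.exp A * NormedSpace.exp (-A) = 1 := fun A => by
    rw [← Matrix.exp_add_of_commute A (-A) (Commute.refl A).neg_right, add_neg_cancel,
      NormedSpace.exp_zero]
  rw [← map_mul, map_neg, h, map_one]

/-- The exponential of an endomorphism, as an element of `GL(V)`. -/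
def expGL {V : Type*} [AddCommGroup V] [Module ℂ V] [FiniteDimensional ℂ V]
    (f : Module.End ℂ V) : (Module.End ℂ V)ˣ where
  val := expEnd f
  inv := expEnd (-f)
  val_inv := expEnd_mul_neg f
  inv_val := by simpa using expEnd_mul_neg (-f)

/-! ### Gradings, Cartan subspaces, the little Weyl group, restricted roots -/

section Grading

variable {L : Type*} [LieRing L] [LieAlgebra ℂ L]

/-- The graded component `𝔤_j = {x | θ x = ω ^ j x}`. -/
def gradedPart (θ : L ≃ₗ⁅ℂ⁆ L) (ω : ℂ) (j : ℕ) : Submodule ℂ L where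
  carrier := {x | θ x = ω ^ j • x}
  add_mem' := by
    intro a b ha hb
    simp only [Set.mem_ofPred_eq] at *
    rw [map_add, ha, hb, smul_add]
  zero_mem' := by simp
  smul_mem' := by
    intro c x hx
    simp only [Set.mem_ofPred_eq] at *
    rw [map_smul, hx, smul_comm]

/-- A Cartan subspace: an abelian subspace of `𝔤_1` consisting of semisimple elements of `𝔤`,
maximal with these properties. -/
def IsCartanSubspace (θ : L ≃ₗ⁅ℂ⁆ L) (ω : ℂ) (c : Submodule ℂ L) : Prop :=
  Maximal (fun a : Submodule ℂ L => a ≤ gradedPart θ ω 1 ∧ (∀ x ∈ a, ∀ y ∈ a, ⁅x, y⁆ = 0) ∧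
    ∀ x ∈ a, (LieAlgebra.ad ℂ L x).IsSemisimple) c

/-- The homogeneous component `𝔥_1 = 𝔥 ∩ 𝔤_1` of a subalgebra `𝔥`. -/
def cartanPart (H : LieSubalgebra ℂ L) (θ : L ≃ₗ⁅ℂ⁆ L) (ω : ℂ) : Submodule ℂ L :=
  H.toSubmodule ⊓ gradedPart θ ω 1

/-- The inclusion `ρ : 𝔥_1 → 𝔥`. -/
def rho (H : LieSubalgebra ℂ L) (θ : L ≃ₗ⁅ℂ⁆ L) (ω : ℂ) : cartanPart H θ ω →ₗ[ℂ] H :=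
  Submodule.inclusion (p := cartanPart H θ ω) (p' := H.toSubmodule) inf_le_left

/-- The group `G_0`. A connected semisimple complex algebraic group `G` with Lie algebra `𝔤` is a
closed subgroup of some `GL(V)`; equivalently it is given by a faithful finite-dimensional
representation `V` of `𝔤`, and `G` is generated by the exponentials of the elements of `𝔤` acting
on `V`. Its connected subgroup with Lie algebra `𝔤_0` is generated by the exponentials of the
elements of `𝔤_0`. The adjoint group is the case `V = 𝔤`. -/
def connectedSubgroupZero (V : Type*) [AddCommGroup V] [Module ℂ V] [FiniteDimensional ℂ V]
    [LieRingModule L V] [LieModule ℂ L V] (θ : L ≃ₗ⁅ℂ⁆ L) (ω : ℂ) :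
    Subgroup (Module.End ℂ V)ˣ :=
  Subgroup.closure {g | ∃ x ∈ gradedPart θ ω 0, g = expGL (LieModule.toEnd ℂ L V x)}

/-- `g ∈ G_0` lifts `s ∈ GL(𝔠)`: it normalizes `𝔠` and acts on it as `s` under the adjoint action,
that is, `Ad(g) y = s y` for `y ∈ 𝔠`. Inside `End(V)`, `Ad(g) y` is the conjugate `g y g⁻¹`. -/
def Lifts (V : Type*) [AddCommGroup V] [Module ℂ V] [FiniteDimensional ℂ V]
    [LieRingModule L V] [LieModule ℂ L V] (θ : L ≃ₗ⁅ℂ⁆ L) (ω : ℂ) (c : Submodule ℂ L)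
    (g : (Module.End ℂ V)ˣ) (s : c ≃ₗ[ℂ] c) : Prop :=
  g ∈ connectedSubgroupZero V θ ω ∧
    ∀ y : c, (g : Module.End ℂ V) * LieModule.toEnd ℂ L V (y : L) * (g⁻¹ : (Module.End ℂ V)ˣ) =
      LieModule.toEnd ℂ L V (s y : L)

/-- The little Weyl group `W = N_{G_0}(𝔠) / Z_{G_0}(𝔠)`, as a subgroup of `GL(𝔠)`: the group of the
transformations of `𝔠` induced by the elements of `G_0` that normalize `𝔠`. -/
def littleWeylGroup (V : Type*) [AddCommGroup V] [Module ℂ V] [FiniteDimensional ℂ V]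
    [LieRingModule L V] [LieModule ℂ L V] (θ : L ≃ₗ⁅ℂ⁆ L) (ω : ℂ) (c : Submodule ℂ L) :
    Subgroup (c ≃ₗ[ℂ] c) where
  carrier := {s | ∃ g, Lifts V θ ω c g s}
  mul_mem' := by
    rintro s t ⟨g, hg, hs⟩ ⟨h, hh, ht⟩
    refine ⟨g * h, mul_mem hg hh, fun y => ?_⟩
    rw [LinearEquiv.mul_apply, ← hs, ← ht]
    simp only [mul_inv_rev, Units.val_mul, mul_assoc]
  one_mem' := ⟨1, one_mem _, fun y => by simp⟩
  inv_mem' := by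
    rintro s ⟨g, hg, hs⟩
    refine ⟨g⁻¹, inv_mem hg, fun y => ?_⟩
    have h := hs (s⁻¹ y)
    rw [← LinearEquiv.mul_apply, mul_inv_cancel] at h
    simp only [LinearEquiv.coe_one, id_eq] at h
    rw [← h]
    simp [mul_assoc]

/-- The space `Π_s = ker (s - id)` of fixed points. -/
def fixedSpace {c : Submodule ℂ L} (s : c ≃ₗ[ℂ] c) : Submodule ℂ c :=
  LinearMap.ker ((s : c →ₗ[ℂ] c) - LinearMap.id)

/-- A (complex) reflection: a linear transformation of finite order with
`dim ker (s - id) = dim 𝔠 - 1`. -/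
def IsReflection {c : Submodule ℂ L} (s : c ≃ₗ[ℂ] c) : Prop :=
  IsOfFinOrder s ∧ Module.finrank ℂ (fixedSpace s) + 1 = Module.finrank ℂ c

end Grading

section Roots

variable {L : Type*} [LieRing L] [LieAlgebra ℂ L] [FiniteDimensional ℂ L] [IsKilling ℂ L]
  (H : LieSubalgebra ℂ L) [H.IsCartanSubalgebra]

/-- The restriction `α ∘ ρ` of a root `α` to `𝔠 = 𝔥_1`. -/
def restrictRoot (θ : L ≃ₗ⁅ℂ⁆ L) (ω : ℂ) (α : H.root) :
    Module.Dual ℂ (cartanPart H θ ω) :=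
  (rootSystem H).root α ∘ₗ rho H θ ω

/-- The set `Σ` of restricted roots: the non-zero restrictions of roots to `𝔠 = 𝔥_1`. -/
def restrictedRoots (θ : L ≃ₗ⁅ℂ⁆ L) (ω : ℂ) : Set (Module.Dual ℂ (cartanPart H θ ω)) :=
  Set.range (restrictRoot H θ ω) \ {0}

variable {H}

/-- The root `-α`. -/
def negRoot (α : H.root) : H.root :=
  ⟨-α.1, by
    have h := α.2
    simp only [Finset.mem_filter, Finset.mem_univ, true_and] at h ⊢
    simpa using h⟩

/-- The restriction to `𝔥` of an automorphism that maps `𝔥` onto itself. -/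
def cartanEquiv (θ : L ≃ₗ⁅ℂ⁆ L) (hθ : ∀ x, θ x ∈ H ↔ x ∈ H) : H ≃ₗ[ℂ] H where
  toFun x := ⟨θ x, (hθ x).2 x.2⟩
  invFun x := ⟨θ.symm x, (hθ _).1 (by simp)⟩
  map_add' x y := by ext; simp
  map_smul' a x := by ext; simp
  left_inv x := by ext; simp
  right_inv x := by ext; simp

/-- The action `θ · μ = μ ∘ θ⁻¹` on `𝔥^*`. -/
def dualAct (θ : L ≃ₗ⁅ℂ⁆ L) (hθ : ∀ x, θ x ∈ H ↔ x ∈ H) (μ : Module.Dual ℂ H) :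
    Module.Dual ℂ H :=
  μ ∘ₗ (cartanEquiv θ hθ).symm.toLinearMap

/-- The orbit `O_μ = {θ^i · μ | 0 ≤ i ≤ m - 1}`. -/
def thetaOrbit (θ : L ≃ₗ⁅ℂ⁆ L) (hθ : ∀ x, θ x ∈ H ↔ x ∈ H) (m : ℕ) (μ : Module.Dual ℂ H) :
    Set (Module.Dual ℂ H) :=
  {ν | ∃ i < m, ν = (dualAct θ hθ)^[i] μ}

end Roots

/-! ### The four families of diagram automorphisms -/

/-- The four families: `so n` is `𝔰𝔬_{2n+2}` with `m = 2`, `sl n` is `𝔰𝔩_{2n}` with `m = 2` (both for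
`n ≥ 2`), `e6` is `E_6` with `m = 2`, and `so8` is `𝔰𝔬_8` with `m = 3`. -/
inductive DiagramType
  | so (n : ℕ) (hn : 2 ≤ n)
  | sl (n : ℕ) (hn : 2 ≤ n)
  | e6
  | so8

namespace DiagramType

/-- The order `m` of the diagram automorphism. -/
def order : DiagramType → ℕ
  | so _ _ => 2
  | sl _ _ => 2
  | e6 => 2
  | so8 => 3

/-- The number of simple roots `α_1, …, α_N`; the root `α_k` has index `k - 1` in `Fin N`. -/
def rank : DiagramType → ℕ
  | so n _ => n + 1
  | sl n _ => 2 * n - 1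
  | e6 => 6
  | so8 => 4

/-- The Cartan matrix. In type `D_{n+1}` the end nodes are `α_n = ε_n - ε_{n+1}` and
`α_{n+1} = ε_n + ε_{n+1}`. In type `E_6`, the nodes `α_1, …, α_5` form a chain, and `α_6` is joined
to `α_3`. -/
def cartanMatrix : (T : DiagramType) → Matrix (Fin T.rank) (Fin T.rank) ℤ
  | so n _ => CartanMatrix.D (n + 1)
  | sl n _ => CartanMatrix.A (2 * n - 1)
  | e6 => CartanMatrix.E₆.submatrix ![0, 2, 3, 4, 5, 1] ![0, 2, 3, 4, 5, 1]
  | so8 => CartanMatrix.D 4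

/-- The symmetry of the Dynkin diagram: `α_n ↔ α_{n+1}` for `D_{n+1}`; `α_k ↔ α_{2n-k}` for
`A_{2n-1}`; `α_k ↔ α_{6-k}` (`k ≤ 5`), `α_6 ↦ α_6` for `E_6`; `α_1 ↦ α_3 ↦ α_4 ↦ α_1`, `α_2 ↦ α_2`
for `D_4`, `m = 3`. -/
def symmetry : (T : DiagramType) → Fin T.rank → Fin T.rank
  | so n _ => Equiv.swap (⟨n - 1, by omega⟩ : Fin (n + 1)) ⟨n, by omega⟩
  | sl _ _ => Fin.rev
  | e6 => (![4, 3, 2, 1, 0, 5] : Fin 6 → Fin 6)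
  | so8 => (![2, 1, 3, 0] : Fin 4 → Fin 4)

/-- The table of representatives. Each of them is a sum of distinct simple roots, described by the
set of simple roots that occur: `α_{n+1} = ε_n + ε_{n+1}`; `α_i + ⋯ + α_{j-1} = ε_i - ε_j` for
`1 ≤ i < j ≤ 2n`, `j ≠ 2n + 1 - i`; `α_i + ⋯ + α_{j-1} = ε_i - ε_j` for `1 ≤ i < j ≤ 6`,
`j ≠ 7 - i`; `α_1 = ε_1 - ε_2`. -/
def IsTableEntry : (T : DiagramType) → Finset (Fin T.rank) → Prop
  | so n _, S => S = ({Fin.last n} : Finset (Fin (n + 1)))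
  | sl n _, S => ∃ i j : ℕ, 1 ≤ i ∧ i < j ∧ j ≤ 2 * n ∧ i + j ≠ 2 * n + 1 ∧
      ∀ k, k ∈ S ↔ i ≤ k.val + 1 ∧ k.val + 1 ≤ j - 1
  | e6, S => ∃ i j : ℕ, 1 ≤ i ∧ i < j ∧ j ≤ 6 ∧ i + j ≠ 7 ∧
      ∀ k, k ∈ S ↔ i ≤ k.val + 1 ∧ k.val + 1 ≤ j - 1
  | so8, S => S = ({0} : Finset (Fin 4))

end DiagramType

/-- A diagram automorphism `θ` of type `T` of a complex Lie algebra `𝔤` with Cartan subalgebra `𝔥`,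
with the choices that enter its definition: a base of the root system, labelled as in the Dynkin
diagram of `T`, and root vectors `e_α` with relations of Chevalley type. The Cartan subalgebra is
`θ`-stable, `θ` permutes the simple roots by the symmetry of the diagram, and `θ(e_α) = e_{θ·α}` for
every root `α`. As all roots are long (of squared length 2), the identification of `𝔥^*` with `𝔥`
takes `α` to the coroot of `α`. -/
structure DiagramAutomorphism (T : DiagramType) {L : Type*} [LieRing L] [LieAlgebra ℂ L]
    [FiniteDimensional ℂ L] [IsKilling ℂ L] (H : LieSubalgebra ℂ L) [H.IsCartanSubalgebra] where
  /-- The system of simple roots. -/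
  base : (rootSystem H).Base
  /-- The labelling of the simple roots. -/
  label : Fin T.rank ≃ base.support
  cartanMatrix_eq : ∀ i j, base.cartanMatrix (label i) (label j) = T.cartanMatrix i j
  /-- The root vectors `e_α`. -/
  e : H.root → L
  e_mem : ∀ α : H.root, e α ∈ rootSpace H α.1
  lie_e_neg : ∀ α : H.root, ⁅e α, e (negRoot α)⁆ = -((rootSystem H).coroot α : L)
  lie_e_add : ∀ α β γ : H.root,
    (rootSystem H).root α + (rootSystem H).root β = (rootSystem H).root γ →
      ⁅e α, e β⁆ = e γ ∨ ⁅e α, e β⁆ = -e γ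
  /-- The automorphism. -/
  θ : L ≃ₗ⁅ℂ⁆ L
  map_mem_iff : ∀ x, θ x ∈ H ↔ x ∈ H
  act_simple : ∀ i, dualAct θ map_mem_iff ((rootSystem H).root (label i)) =
    (rootSystem H).root (label (T.symmetry i))
  map_e : ∀ α β : H.root,
    dualAct θ map_mem_iff ((rootSystem H).root α) = (rootSystem H).root β → θ (e α) = e β

namespace DiagramAutomorphism

variable {T : DiagramType} {L : Type*} [LieRing L] [LieAlgebra ℂ L] [FiniteDimensional ℂ L]
  [IsKilling ℂ L] {H : LieSubalgebra ℂ L} [H.IsCartanSubalgebra] (D : DiagramAutomorphism T H)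

/-- The vector `e_α^{(j)} = (|O_α| / m) ∑_{i < m} ω^{-ij} θ^i(e_α)`. -/
def eComp (ω : ℂ) (j : ℕ) (α : H.root) : L :=
  (((thetaOrbit D.θ D.map_mem_iff T.order ((rootSystem H).root α)).ncard : ℂ) / (T.order : ℂ)) •
    ∑ i ∈ Finset.range T.order, (ω ^ (i * j))⁻¹ • (D.θ)^[i] (D.e α)

/-- The root `α` is one of the representatives in the table. -/
def IsTableRoot (α : H.root) : Prop :=
  ∃ S : Finset (Fin T.rank), T.IsTableEntry S ∧
    (rootSystem H).root α = ∑ k ∈ S, (rootSystem H).root (D.label k)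

end DiagramAutomorphism

end ThetaGroup

end

open ThetaGroup

noncomputable section

namespace ThetaGroup

open LieAlgebra LieAlgebra.IsKilling

/-! ### Conjugation by exponentials -/

/-! The Cartan matrices are symmetric, so all roots may be given squared length 2 and `α ↦ α^∨`
extends linearly. Two features of `θ` then carry everything: it preserves heights, and it fixes
`e_α` as soon as it fixes `α`.

A root vanishes on `𝔠` exactly when `θ` fixes it (`restrictRoot_eq_zero_iff`); this comes from
evaluating it on the projection to `𝔠` of its own coroot. Hence the components of an element of
`𝔤_1` commuting with `𝔠` lie in `𝔥` or in root spaces fixed pointwise by `θ`, and the eigenvalue `ω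
≠ 1` forces the element into `𝔥`. So `𝔠` is maximal.

Suppose the `θ`-orbit of `α` consists of `m` pairwise orthogonal roots. Put `F = e_α^{(0)} +
e_{-α}^{(0)}`, `v = ∑ ω^{-i} θ^i(α^∨)` and `w = ∑ ω^{-i} θ^i(e_α - e_{-α})`. Then `[F, y] = -α(y) w`
on `𝔠`, `[F, w] = 2v` and `α(v) = 2`. Thus `ad F` kills `ker α` and rotates the plane of `v` and `w`
with speed 2, so time `π/2` is a half turn: `exp(π/2 F)` acts on `𝔠` as the reflection `y ↦ y - α(y)
v` (`OrthogonalOrbit.exists_reflection`). The computation uses only commutators, hence is valid in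
every representation `V`.

For `m = 2` each root not fixed by `θ` has an orthogonal orbit (`pairing_perm_self_eq_zero`); for
triality this is read off the Cartan matrix for the table root. It remains to see that the table
meets every hyperplane `Π_σ`. In the two orthogonal families the restrictions of all roots are
proportional; in type `A` every moved root is in the table up to sign; in type `E₆` the restricted
roots are found by solving `u² + v² - uv = 1`. -/

open scoped Matrix.Norms.Operator in
theorem exp_mul_of_commutator {n : Type*} [Fintype n] [DecidableEq n]
    {A Z : Matrix n n ℂ} {c : ℂ} (h : A * Z - Z * A = c • Z) :
    NormedSpace.exp A * Z = Complex.exp c • (Z * NormedSpace.exp A) := by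
  -- The hypothesis reads `Z (A + c) = A Z`, so `Z` intertwines all powers of `A + c` and `A`, hence
  -- their exponentials; the scalar `c` then splits off.
  have hs : SemiconjBy Z (A + algebraMap ℂ _ c) A := by
    rw [SemiconjBy, mul_add, ← Algebra.commutes, ← Algebra.smul_def, ← h]
    abel
  have h1 := (NormedSpace.exp_series_hasSum_exp' (𝕂 := ℂ) A).mul_right Z
  have h2 := (NormedSpace.exp_series_hasSum_exp' (𝕂 := ℂ) (A + algebraMap ℂ _ c)).mul_left Z
  have h3 : NormedSpace.exp A * Z = Z * NormedSpace.exp (A + algebraMap ℂ _ c) := by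
    refine h1.unique (h2.congr_fun fun k => ?_)
    rw [smul_mul_assoc, mul_smul_comm, (hs.pow_right k).eq]
  have h4 : NormedSpace.exp (algebraMap ℂ (Matrix n n ℂ) c) =
      algebraMap ℂ (Matrix n n ℂ) (Complex.exp c) := by
    rw [Complex.exp_eq_exp_ℂ]
    exact (NormedSpace.algebraMap_exp_comm c).symm
  rw [h3, Matrix.exp_add_of_commute _ _ (Algebra.commutes c A).symm, h4, ← mul_assoc,
    ← Algebra.commutes, ← Algebra.smul_def]

theorem expEnd_mul_of_commutator {V : Type*} [AddCommGroup V] [Module ℂ V] [FiniteDimensional ℂ V]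
    {f z : Module.End ℂ V} {c : ℂ} (h : f * z - z * f = c • z) :
    expEnd f * z = Complex.exp c • (z * expEnd f) := by
  set e := LinearMap.toMatrixAlgEquiv (Module.finBasis ℂ V) with he
  have h' : e f * e z - e z * e f = c • e z := by
    rw [← map_mul, ← map_mul, ← map_sub, h, map_smul]
  apply e.injective
  rw [map_mul, map_smul, map_mul, expEnd, ← he, e.apply_symm_apply, exp_mul_of_commutator h']

/-- If `[f, z] = -2 w` and `[f, w] = 2 z` then conjugation by `exp (π / 2 • f)` maps `z` to `-z`. -/
theorem expGL_conj_of_rotation {V : Type*} [AddCommGroup V] [Module ℂ V] [FiniteDimensional ℂ V]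
    {f z w : Module.End ℂ V} (hz : f * z - z * f = (-2 : ℂ) • w)
    (hw : f * w - w * f = (2 : ℂ) • z) :
    (expGL (((Real.pi : ℂ) / 2) • f) : Module.End ℂ V) * z =
      -(z * (expGL (((Real.pi : ℂ) / 2) • f) : Module.End ℂ V)) := by
  -- For `c = ±i` the vector `z + c w` is an eigenvector of `ad f` with eigenvalue `2c`. After
  -- scaling by `π/2` both eigenvalues exponentiate to `-1`, and `z` is half the sum of the two
  -- eigenvectors.
  have key (c : ℂ) (hc : c * c = -1) (hexp : Complex.exp ((Real.pi : ℂ) * c) = -1) :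
      expEnd (((Real.pi : ℂ) / 2) • f) * (z + c • w) =
        -((z + c • w) * expEnd (((Real.pi : ℂ) / 2) • f)) := by
    have h : (((Real.pi : ℂ) / 2) • f) * (z + c • w) - (z + c • w) * (((Real.pi : ℂ) / 2) • f) =
        ((Real.pi : ℂ) * c) • (z + c • w) := by
      have : (((Real.pi : ℂ) / 2) • f) * (z + c • w) - (z + c • w) * (((Real.pi : ℂ) / 2) • f) =
          ((Real.pi : ℂ) / 2) • ((f * z - z * f) + c • (f * w - w * f)) := by
        simp only [mul_add, add_mul, smul_mul_assoc, mul_smul_comm, smul_add, smul_sub,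
          smul_comm c ((Real.pi : ℂ) / 2)]
        abel
      rw [this, hz, hw]
      simp only [smul_add, smul_smul]
      rw [add_comm]
      congr 2
      · ring
      · linear_combination (-(Real.pi : ℂ)) * hc
    rw [expEnd_mul_of_commutator h, hexp, neg_one_smul]
  have h1 := key Complex.I Complex.I_mul_I Complex.exp_pi_mul_I
  have h2 := key (-Complex.I) (by simp) (by
    rw [mul_neg, Complex.exp_neg, Complex.exp_pi_mul_I]; norm_num)
  have h3 : (2 : ℂ) • (expEnd (((Real.pi : ℂ) / 2) • f) * z) =
      (2 : ℂ) • -(z * expEnd (((Real.pi : ℂ) / 2) • f)) := by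
    have e1 : (2 : ℂ) • z = (z + Complex.I • w) + (z + (-Complex.I) • w) := by
      rw [two_smul, neg_smul]; abel
    rw [← mul_smul_comm, smul_neg, ← smul_mul_assoc, e1, mul_add, h1, h2, ← neg_add, ← add_mul]
  exact smul_right_injective _ (two_ne_zero (α := ℂ)) h3

theorem expGL_commute {V : Type*} [AddCommGroup V] [Module ℂ V] [FiniteDimensional ℂ V]
    {f z : Module.End ℂ V} (h : f * z - z * f = 0) (t : ℂ) :
    (expGL (t • f) : Module.End ℂ V) * z = z * (expGL (t • f) : Module.End ℂ V) := by
  have h' : (t • f) * z - z * (t • f) = (0 : ℂ) • z := by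
    rw [smul_mul_assoc, mul_smul_comm, ← smul_sub, h, smul_zero, zero_smul]
  have := expEnd_mul_of_commutator h'
  rwa [Complex.exp_zero, one_smul] at this

/-! ### Root systems with a symmetric Cartan matrix -/

section SymmetricCartan

set_option linter.unusedSectionVars false

variable {ι K M N : Type*} [Field K] [CharZero K] [Finite ι]
  [AddCommGroup M] [Module K M] [AddCommGroup N] [Module K N]
  {P : RootPairing ι K M N} [P.IsRootSystem] [P.IsCrystallographic] [P.IsReduced]

theorem pairing_eq_cartanMatrix (b : P.Base) (i j : b.support) :
    P.pairing i j = (b.cartanMatrix i j : K) := by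
  simpa using (b.algebraMap_cartanMatrixIn_apply ℤ i j).symm

/-- If the Cartan matrix is symmetric, then the map from roots to coroots is linear, and the
resulting bilinear form is symmetric. -/
theorem exists_linearMap_root_eq_coroot (b : P.Base)
    (hs : ∀ i j, b.cartanMatrix i j = b.cartanMatrix j i) :
    ∃ Φ : M →ₗ[K] N, (∀ i, Φ (P.root i) = P.coroot i) ∧
      ∀ x y, P.toLinearMap x (Φ y) = P.toLinearMap y (Φ x) := by
  let Φ : M →ₗ[K] N := b.toWeightBasis.constr K fun i => P.coroot i
  have hΦ (i : b.support) : Φ (P.root i) = P.coroot i := by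
    rw [← b.toWeightBasis_apply]; exact b.toWeightBasis.constr_basis K _ i
  have hsymm (x y : M) : P.toLinearMap x (Φ y) = P.toLinearMap y (Φ x) := by
    have : P.toLinearMap.compl₂ Φ = (P.toLinearMap.compl₂ Φ).flip := by
      refine b.toWeightBasis.ext fun i => b.toWeightBasis.ext fun j => ?_
      simp only [LinearMap.compl₂_apply, LinearMap.flip_apply, b.toWeightBasis_apply, hΦ]
      change P.pairing i j = P.pairing j i
      rw [pairing_eq_cartanMatrix, pairing_eq_cartanMatrix, hs]
    exact LinearMap.congr_fun₂ this x y
  refine ⟨Φ, fun i => ?_, hsymm⟩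
  induction i using b.induction_reflect with
  | h₀ i hi => simp [RootPairing.root_reflectionPerm, RootPairing.coroot_reflectionPerm, hi]
  | h₁ i hi => exact hΦ ⟨i, hi⟩
  | h₂ i j hi hj =>
    have hj' := hΦ ⟨j, hj⟩
    -- The reflection in `j` subtracts a multiple of the root, the coreflection a multiple of the
    -- coroot; symmetry of the form makes the two coefficients equal.
    have := hsymm (P.root i) (P.root j)
    simp only [hi, hj'] at this
    rw [RootPairing.root_reflectionPerm, RootPairing.coroot_reflectionPerm,
      RootPairing.reflection_apply, RootPairing.coreflection_apply, map_sub, map_smul, hi, hj']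
    congr 2

theorem pairing_comm_of_symm (b : P.Base)
    (hs : ∀ i j, b.cartanMatrix i j = b.cartanMatrix j i) (i j : ι) :
    P.pairing i j = P.pairing j i := by
  obtain ⟨Φ, h1, h2⟩ := exists_linearMap_root_eq_coroot b hs
  simpa [h1] using h2 (P.root i) (P.root j)

/-- The sum of two orthogonal roots has squared length 4, while every root has squared length 2. -/
theorem root_add_root_ne_of_pairing_eq_zero (b : P.Base)
    (hs : ∀ i j, b.cartanMatrix i j = b.cartanMatrix j i) {i j : ι} (h : P.pairing i j = 0)
    (k : ι) :
    P.root i + P.root j ≠ P.root k := by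
  intro hk
  obtain ⟨Φ, h1, -⟩ := exists_linearMap_root_eq_coroot b hs
  have h2 : P.toLinearMap (P.root k) (Φ (P.root k)) = 2 := by simp [h1]
  have h3 : P.pairing j i = 0 := by rw [← pairing_comm_of_symm b hs, h]
  rw [← hk] at h2
  simp only [map_add, LinearMap.add_apply, h1, RootPairing.root_coroot_eq_pairing,
    RootPairing.pairing_same, h, h3] at h2
  norm_num at h2

theorem pairing_sum_sum (b : P.Base)
    (hs : ∀ i j, b.cartanMatrix i j = b.cartanMatrix j i) {κ : Type*} [Fintype κ]
    (r : κ → ι) (f g : κ → K) {i j : ι}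
    (hi : P.root i = ∑ k, f k • P.root (r k)) (hj : P.root j = ∑ k, g k • P.root (r k)) :
    P.pairing i j = ∑ k, ∑ l, f k * g l * P.pairing (r k) (r l) := by
  obtain ⟨Φ, h1, -⟩ := exists_linearMap_root_eq_coroot b hs
  rw [← RootPairing.root_coroot_eq_pairing, ← h1, hi, hj]
  simp only [map_sum, map_smul, LinearMap.sum_apply, LinearMap.smul_apply, h1, smul_eq_mul,
    RootPairing.root_coroot_eq_pairing, Finset.mul_sum, mul_assoc]
  rw [Finset.sum_comm]
  exact Finset.sum_congr rfl fun k _ => Finset.sum_congr rfl fun l _ => mul_left_comm ..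

end SymmetricCartan

/-! ### Combinatorics of the four diagrams -/

namespace DiagramType

theorem cartanMatrix_symm (T : DiagramType) (i j : Fin T.rank) :
    T.cartanMatrix i j = T.cartanMatrix j i := by
  cases T with
  | so n hn => exact (CartanMatrix.D_isSymm (n + 1)).apply j i
  | sl n hn => exact (CartanMatrix.A_isSymm (2 * n - 1)).apply j i
  | e6 => exact CartanMatrix.E₆_isSymm.apply _ _
  | so8 => exact (CartanMatrix.D_isSymm 4).apply j i

theorem symmetry_iterate_order (T : DiagramType) (i : Fin T.rank) :
    T.symmetry^[T.order] i = i := by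
  cases T with
  | so n hn => exact Equiv.swap_apply_self _ _ i
  | sl n hn => exact Fin.rev_rev i
  | e6 => revert i; decide
  | so8 => revert i; decide

theorem order_eq (T : DiagramType) : T.order = 2 ∨ T.order = 3 := by
  cases T <;> simp [order]

theorem order_pos (T : DiagramType) : 0 < T.order := by
  cases T <;> simp [order]

end DiagramType

/-! ### Roots and root vectors under the automorphism -/

section

variable {L : Type*} [LieRing L] [LieAlgebra ℂ L] [FiniteDimensional ℂ L]
  [IsKilling ℂ L] {H : LieSubalgebra ℂ L} [H.IsCartanSubalgebra]

set_option linter.unusedSectionVars false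

/-- `dualAct` as a linear map. -/
def dualActHom (θ : L ≃ₗ⁅ℂ⁆ L) (hθ : ∀ x, θ x ∈ H ↔ x ∈ H) :
    Module.Dual ℂ H →ₗ[ℂ] Module.Dual ℂ H :=
  LinearMap.lcomp ℂ ℂ (cartanEquiv θ hθ).symm.toLinearMap

theorem dualActHom_apply (θ : L ≃ₗ⁅ℂ⁆ L) (hθ : ∀ x, θ x ∈ H ↔ x ∈ H) (μ : Module.Dual ℂ H) :
    dualActHom θ hθ μ = dualAct θ hθ μ := rfl

theorem root_negRoot (α : H.root) :
    (rootSystem H).root (negRoot α) = -(rootSystem H).root α := by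
  ext x; simp [negRoot]

theorem coroot_negRoot (α : H.root) :
    (rootSystem H).coroot (negRoot α) = -(rootSystem H).coroot α := by
  simp [negRoot]

theorem negRoot_negRoot (α : H.root) : negRoot (negRoot α) = α :=
  (rootSystem H).root.injective (by simp only [root_negRoot, neg_neg])

theorem isNonZero_of_root (α : H.root) : α.1.IsNonZero := by
  have h := α.2
  simp only [Finset.mem_filter, Finset.mem_univ, true_and] at h
  exact h

theorem mem_root_of_mem_rootSpace {f : Module.Dual ℂ H} (hf : f ≠ 0) {x : L} (hx : x ≠ 0)
    (h : x ∈ rootSpace H f) : ∃ β : H.root, f = (rootSystem H).root β := by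
  have hne : rootSpace H f ≠ ⊥ := fun h0 => hx (by simpa [h0] using h)
  let w : LieModule.Weight ℂ H L := ⟨f, hne⟩
  have hw : w.IsNonZero := fun h0 => hf (by
    ext y; exact congrFun (show (f : H → ℂ) = 0 from h0) y)
  exact ⟨⟨w, by simpa using hw⟩, by ext y; rfl⟩

end

namespace DiagramAutomorphism

variable {T : DiagramType} {L : Type*} [LieRing L] [LieAlgebra ℂ L] [FiniteDimensional ℂ L]
  [IsKilling ℂ L] {H : LieSubalgebra ℂ L} [H.IsCartanSubalgebra] (D : DiagramAutomorphism T H)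

theorem e_ne_zero (α : H.root) : D.e α ≠ 0 := by
  intro h
  have h1 := D.lie_e_neg α
  rw [h, zero_lie, eq_comm, neg_eq_zero] at h1
  simp at h1

theorem lie_e (h : H) (α : H.root) : ⁅(h : L), D.e α⁆ = (rootSystem H).root α h • D.e α :=
  lie_eq_smul_of_mem_rootSpace (D.e_mem α) h

theorem mem_span_e (α : H.root) {x : L} (hx : x ∈ rootSpace H α.1) : ∃ t : ℂ, x = t • D.e α := by
  have h1 := finrank_rootSpace_eq_one α.1 (isNonZero_of_root α)
  obtain ⟨t, ht⟩ := (finrank_eq_one_iff_of_nonzero' (⟨D.e α, D.e_mem α⟩ : rootSpace H α.1)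
    (by simpa using D.e_ne_zero α)).1 h1 ⟨x, hx⟩
  exact ⟨t, by simpa using congrArg Subtype.val ht.symm⟩

/-- The vector `θ(e_α)` is non-zero of weight `θ · α`. -/
theorem exists_dualAct_eq_root (α : H.root) :
    ∃ β, dualAct D.θ D.map_mem_iff ((rootSystem H).root α) = (rootSystem H).root β := by
  refine mem_root_of_mem_rootSpace (x := D.θ (D.e α)) ?_ (by simpa using D.e_ne_zero α) ?_
  · intro h
    apply (rootSystem H).ne_zero α
    ext x
    have := LinearMap.congr_fun h (cartanEquiv D.θ D.map_mem_iff x)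
    simpa [dualAct] using this
  · refine LieModule.weightSpace_le_genWeightSpace L _ ?_
    rw [LieModule.mem_weightSpace]
    intro h
    have h1 := congrArg D.θ (D.lie_e ((cartanEquiv D.θ D.map_mem_iff).symm h) α)
    have h2 : D.θ ((cartanEquiv D.θ D.map_mem_iff).symm h : L) = h :=
      congrArg Subtype.val ((cartanEquiv D.θ D.map_mem_iff).apply_symm_apply h)
    rw [LieEquiv.map_lie, map_smul, h2] at h1
    exact h1

/-- The permutation of the roots induced by the automorphism. -/
def perm (α : H.root) : H.root := (D.exists_dualAct_eq_root α).choose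

theorem root_perm (α : H.root) : (rootSystem H).root (D.perm α) =
    dualAct D.θ D.map_mem_iff ((rootSystem H).root α) :=
  (D.exists_dualAct_eq_root α).choose_spec.symm

theorem map_e_eq (α : H.root) : D.θ (D.e α) = D.e (D.perm α) :=
  D.map_e _ _ (D.root_perm α).symm

theorem perm_negRoot (α : H.root) : D.perm (negRoot α) = negRoot (D.perm α) := by
  apply (rootSystem H).root.injective
  simp only [root_perm, root_negRoot, ← dualActHom_apply, map_neg]

/-- Apply `θ` to `[e_α, e_{-α}] = -α^∨`. -/
theorem coroot_perm (α : H.root) :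
    ((rootSystem H).coroot (D.perm α) : L) = D.θ ((rootSystem H).coroot α) := by
  have h1 := D.lie_e_neg (D.perm α)
  rw [← perm_negRoot, ← map_e_eq, ← map_e_eq, ← LieEquiv.map_lie, D.lie_e_neg, map_neg] at h1
  exact (neg_injective h1).symm

theorem root_perm_cartanEquiv (α : H.root) (x : H) :
    (rootSystem H).root (D.perm α) (cartanEquiv D.θ D.map_mem_iff x) =
      (rootSystem H).root α x := by
  rw [root_perm]; simp [dualAct]

theorem perm_label (i : Fin T.rank) : D.perm (D.label i) = D.label (T.symmetry i) := by
  apply (rootSystem H).root.injective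
  rw [root_perm, D.act_simple]

theorem perm_iterate_label (i : Fin T.rank) (k : ℕ) :
    D.perm^[k] (D.label i) = D.label (T.symmetry^[k] i) := by
  induction k with
  | zero => rfl
  | succ k ih => rw [Function.iterate_succ_apply', ih, perm_label, Function.iterate_succ_apply']

theorem root_perm_iterate (α : H.root) (k : ℕ) : (rootSystem H).root (D.perm^[k] α) =
    (dualAct D.θ D.map_mem_iff)^[k] ((rootSystem H).root α) := by
  induction k with
  | zero => rfl
  | succ k ih => rw [Function.iterate_succ_apply', root_perm, ih, Function.iterate_succ_apply']

/-- The simple roots form a basis of `𝔥^*`, and the diagram symmetry permuting them has `m`-th power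
the identity. -/
theorem dualActHom_pow_order : dualActHom D.θ D.map_mem_iff ^ T.order = 1 := by
  refine D.base.toWeightBasis.ext fun i => ?_
  obtain ⟨k, rfl⟩ := D.label.surjective i
  rw [RootPairing.Base.toWeightBasis_apply, Module.End.pow_apply]
  change (dualAct D.θ D.map_mem_iff)^[T.order] _ = _
  rw [← root_perm_iterate, perm_iterate_label, T.symmetry_iterate_order]
  rfl

theorem perm_iterate_order (α : H.root) : D.perm^[T.order] α = α := by
  apply (rootSystem H).root.injective
  rw [root_perm_iterate]
  have := LinearMap.congr_fun D.dualActHom_pow_order ((rootSystem H).root α)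
  rwa [Module.End.pow_apply] at this

theorem iterate_e (α : H.root) (k : ℕ) : D.θ^[k] (D.e α) = D.e (D.perm^[k] α) := by
  induction k with
  | zero => rfl
  | succ k ih => rw [Function.iterate_succ_apply', ih, Function.iterate_succ_apply', map_e_eq]

theorem perm_iterate_negRoot (α : H.root) (k : ℕ) :
    D.perm^[k] (negRoot α) = negRoot (D.perm^[k] α) := by
  induction k with
  | zero => rfl
  | succ k ih => rw [Function.iterate_succ_apply', ih, Function.iterate_succ_apply', perm_negRoot]

theorem base_cartanMatrix_symm (i j : D.base.support) :
    D.base.cartanMatrix i j = D.base.cartanMatrix j i := by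
  obtain ⟨k, rfl⟩ := D.label.surjective i
  obtain ⟨l, rfl⟩ := D.label.surjective j
  rw [D.cartanMatrix_eq, D.cartanMatrix_eq, T.cartanMatrix_symm]

theorem pairing_label (i j : Fin T.rank) :
    (rootSystem H).pairing (D.label i) (D.label j) = (T.cartanMatrix i j : ℂ) := by
  rw [pairing_eq_cartanMatrix, D.cartanMatrix_eq]

theorem pairing_comm (D : DiagramAutomorphism T H) (α β : H.root) :
    (rootSystem H).pairing α β = (rootSystem H).pairing β α :=
  pairing_comm_of_symm D.base D.base_cartanMatrix_symm α β

theorem exists_root_eq_sum_label (α : H.root) : ∃ f : Fin T.rank → ℤ,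
    ((∀ i, 0 ≤ f i) ∨ ∀ i, f i ≤ 0) ∧
      (rootSystem H).root α = ∑ i, (f i : ℂ) • (rootSystem H).root (D.label i) := by
  obtain ⟨f, -, h1, h2⟩ := D.base.exists_root_eq_sum_int α
  refine ⟨fun i => f (D.label i), h1.imp (fun h i => h.le _) (fun h i => h.le _), ?_⟩
  rw [h2, ← Finset.sum_coe_sort, ← D.label.sum_comp]
  simp only [Int.cast_smul_eq_zsmul]

/-- The height, equal to 1 on each simple root, is invariant under `θ`, so such a root would have
height 0. As its coefficients share one sign, they would all vanish. -/
theorem perm_ne_negRoot (α : H.root) : D.perm α ≠ negRoot α := by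
  intro h
  obtain ⟨f, hf, hα⟩ := D.exists_root_eq_sum_label α
  let ht : Module.Dual ℂ H →ₗ[ℂ] ℂ := D.base.toWeightBasis.constr ℂ fun _ => 1
  have ht_label (i : Fin T.rank) : ht ((rootSystem H).root (D.label i)) = 1 := by
    rw [← RootPairing.Base.toWeightBasis_apply]
    exact D.base.toWeightBasis.constr_basis ℂ _ _
  have ht_act (x) : ht (dualActHom D.θ D.map_mem_iff x) = ht x := by
    suffices ht ∘ₗ dualActHom D.θ D.map_mem_iff = ht from LinearMap.congr_fun this x
    refine D.base.toWeightBasis.ext fun i => ?_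
    obtain ⟨k, rfl⟩ := D.label.surjective i
    rw [RootPairing.Base.toWeightBasis_apply, LinearMap.comp_apply, dualActHom_apply,
      D.act_simple, ht_label, ht_label]
  have h1 : ht ((rootSystem H).root α) = 0 := by
    have := ht_act ((rootSystem H).root α)
    rw [dualActHom_apply, ← root_perm, h, root_negRoot, map_neg] at this
    linear_combination (-1 / 2 : ℂ) * this
  have h2 : ∑ i, f i = 0 := by
    rw [hα] at h1
    simp only [map_sum, map_smul, ht_label, smul_eq_mul, mul_one] at h1
    exact_mod_cast h1
  have h3 : ∀ i, f i = 0 := by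
    rcases hf with hf | hf
    · simpa using (Finset.sum_eq_zero_iff_of_nonneg fun i _ => hf i).1 h2
    · simpa using (Finset.sum_eq_zero_iff_of_nonpos fun i _ => hf i).1 h2
  exact (rootSystem H).ne_zero α (by simp [hα, h3])

/-- A non-zero bracket would make `α + β` a root or zero. The first contradicts the length count for
orthogonal roots, the second would give pairing `-2`. -/
theorem lie_e_eq_zero {α β : H.root} (h : (rootSystem H).pairing α β = 0) :
    ⁅D.e α, D.e β⁆ = 0 := by
  by_contra hne
  have hmem : ⁅D.e α, D.e β⁆ ∈
      rootSpace H ((rootSystem H).root α + (rootSystem H).root β : Module.Dual ℂ H) :=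
    LieAlgebra.lie_mem_genWeightSpace_of_mem_genWeightSpace (D.e_mem α) (D.e_mem β)
  by_cases h0 : (rootSystem H).root α + (rootSystem H).root β = 0
  · have h1 : (rootSystem H).root α = -(rootSystem H).root β := eq_neg_of_add_eq_zero_left h0
    rw [← RootPairing.root_coroot_eq_pairing, h1] at h
    simp only [map_neg, LinearMap.neg_apply, RootPairing.root_coroot_eq_pairing,
      RootPairing.pairing_same] at h
    norm_num at h
  · obtain ⟨γ, hγ⟩ := mem_root_of_mem_rootSpace h0 hne hmem
    exact root_add_root_ne_of_pairing_eq_zero D.base D.base_cartanMatrix_symm h γ hγ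

/-- A root that is not fixed by an involutive diagram automorphism is orthogonal to its image. -/
theorem pairing_perm_self_eq_zero (hT : T.order = 2) {α : H.root} (hα : D.perm α ≠ α) :
    (rootSystem H).pairing α (D.perm α) = 0 := by
  have hperm : D.perm (D.perm α) = α := by
    have := D.perm_iterate_order α
    rwa [hT] at this
  have hact : dualActHom D.θ D.map_mem_iff ((rootSystem H).root α) =
      (rootSystem H).root (D.perm α) := (D.root_perm α).symm
  have hact' : dualActHom D.θ D.map_mem_iff ((rootSystem H).root (D.perm α)) =
      (rootSystem H).root α := by rw [dualActHom_apply, ← root_perm, hperm]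
  rw [← (rootSystem H).algebraMap_pairingIn ℤ]
  rcases lt_trichotomy ((rootSystem H).pairingIn ℤ α (D.perm α)) 0 with h | h | h
  -- Negative pairing: `γ = α + θ·α` is a root fixed by `θ`, so `θ` fixes `e_γ`. But `e_γ = ±[e_α, θ
  -- e_α]`, and the involution swaps the two entries, which changes the sign.
  · exfalso
    obtain ⟨γ, hγ⟩ := (rootSystem H).root_add_root_mem_of_pairingIn_neg h fun h' =>
      D.perm_ne_negRoot α ((rootSystem H).root.injective (by rw [root_negRoot, h', neg_neg]))
    have h1 : D.perm γ = γ := by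
      apply (rootSystem H).root.injective
      rw [root_perm, ← dualActHom_apply, hγ, map_add, hact, hact', add_comm]
    have h2 : D.θ ⁅D.e α, D.e (D.perm α)⁆ = -⁅D.e α, D.e (D.perm α)⁆ := by
      rw [LieEquiv.map_lie, map_e_eq, map_e_eq, hperm, lie_skew]
    have h3 : D.θ (D.e γ) = -D.e γ := by
      rcases D.lie_e_add _ _ _ hγ.symm with h | h
      · rwa [h] at h2
      · rw [h, map_neg] at h2; exact neg_injective h2
    rw [map_e_eq, h1] at h3
    have h4 : (2 : ℂ) • D.e γ = 0 := by rw [two_smul]; exact add_eq_zero_iff_eq_neg.2 h3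
    exact D.e_ne_zero γ ((smul_eq_zero.1 h4).resolve_left two_ne_zero)
  · rw [h, map_zero]
  -- Positive pairing: the difference of `α` and `θ·α` is a root that `θ` negates, which heights
  -- exclude.
  · exfalso
    obtain ⟨γ, hγ⟩ := (rootSystem H).root_sub_root_mem_of_pairingIn_pos h (Ne.symm hα)
    apply D.perm_ne_negRoot γ
    apply (rootSystem H).root.injective
    rw [root_perm, ← dualActHom_apply, root_negRoot, hγ, map_sub, hact, hact', neg_sub]

end DiagramAutomorphism

/-! ### Restricted roots and the Cartan subspace -/

/-- Eliminating `ω²` leaves `(b - c) ω = c - a`. Cubing and the injectivity of cubes on `ℤ` give `b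
- c = c - a`, so a non-zero value would force `ω = 1`. -/
theorem int_eq_of_cube_root_relation {ω : ℂ} (hω : IsPrimitiveRoot ω 3) {a b c : ℤ}
    (h : (a : ℂ) + b * ω + c * ω ^ 2 = 0) : a = b ∧ b = c := by
  have h2 : ω ^ 2 = -1 - ω := by
    have := hω.geom_sum_eq_zero (by norm_num)
    simp only [Finset.sum_range_succ, Finset.sum_range_zero, pow_zero, pow_one] at this
    linear_combination this
  have h3 : (((b - c : ℤ)) : ℂ) * ω = ((c - a : ℤ) : ℂ) := by
    rw [h2] at h; push_cast; linear_combination h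
  have h4 : (b - c) ^ 3 = (c - a) ^ 3 := by
    have := congrArg (· ^ 3) h3
    simp only [mul_pow, hω.pow_eq_one, mul_one] at this
    exact_mod_cast this
  have h5 : b - c = c - a := (Odd.strictMono_pow (by decide)).injective h4
  have h6 : b - c = 0 := by
    by_contra hne
    have hne' : ((c - a : ℤ) : ℂ) ≠ 0 := by rw [← h5]; exact_mod_cast hne
    have : ω = 1 := mul_left_cancel₀ hne' (by rw [mul_one, ← h5, h3, h5])
    exact hω.ne_one (by norm_num) this
  omega

namespace DiagramAutomorphism

variable {T : DiagramType} {L : Type*} [LieRing L] [LieAlgebra ℂ L] [FiniteDimensional ℂ L]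
  [IsKilling ℂ L] {H : LieSubalgebra ℂ L} [H.IsCartanSubalgebra] (D : DiagramAutomorphism T H)
  {ω : ℂ}

theorem map_mem_cartanPart {y : L} (hy : y ∈ cartanPart H D.θ ω) : D.θ y = ω • y := by
  simpa [gradedPart] using hy.2

theorem restrictRoot_apply (α : H.root) (y : cartanPart H D.θ ω) :
    restrictRoot H D.θ ω α y = (rootSystem H).root α ⟨y, y.2.1⟩ := rfl

theorem restrictRoot_perm (hω : ω ≠ 0) (α : H.root) :
    restrictRoot H D.θ ω (D.perm α) = ω⁻¹ • restrictRoot H D.θ ω α := by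
  ext y
  have h := D.root_perm_cartanEquiv α ⟨y, y.2.1⟩
  have h1 : cartanEquiv D.θ D.map_mem_iff ⟨y, y.2.1⟩ = ω • (⟨y, y.2.1⟩ : H) :=
    Subtype.ext (D.map_mem_cartanPart y.2)
  rw [h1, map_smul] at h
  rw [LinearMap.smul_apply, restrictRoot_apply, restrictRoot_apply, ← h, smul_eq_mul, smul_eq_mul,
    inv_mul_cancel_left₀ hω]

theorem restrictRoot_perm_iterate (hω : ω ≠ 0) (α : H.root) (k : ℕ) :
    restrictRoot H D.θ ω (D.perm^[k] α) = (ω ^ k)⁻¹ • restrictRoot H D.θ ω α := by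
  induction k with
  | zero => simp
  | succ k ih =>
    rw [Function.iterate_succ_apply', D.restrictRoot_perm hω, ih, smul_smul, pow_succ, mul_inv,
      mul_comm]

theorem restrictRoot_negRoot (α : H.root) :
    restrictRoot H D.θ ω (negRoot α) = -restrictRoot H D.θ ω α := by
  rw [restrictRoot, root_negRoot]; rfl

theorem restrictRoot_eq_sum {κ : Type*} [Fintype κ] {α : H.root} {f : κ → ℂ} {r : κ → H.root}
    (h : (rootSystem H).root α = ∑ k, f k • (rootSystem H).root (r k)) :
    restrictRoot H D.θ ω α = ∑ k, f k • restrictRoot H D.θ ω (r k) := by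
  ext y
  rw [restrictRoot_apply, h]
  simp [restrictRoot_apply, LinearMap.sum_apply]

variable (ω) in
/-- The vector `∑ ω^{-i} θ^i(α^∨)` of `𝔠`. -/
def orbitCoroot (α : H.root) : L :=
  ∑ i ∈ Finset.range T.order, (ω ^ i)⁻¹ • ((rootSystem H).coroot (D.perm^[i] α) : L)

/-- A cyclic shift of the sum: the term of index `m` equals the term of index 0, because both `ω^m`
and the `m`-th power of the permutation are trivial. -/
theorem sum_range_orbit_succ {A : Type*} [AddCommGroup A] [Module ℂ A]
    (hω : IsPrimitiveRoot ω T.order) (F : H.root → A) (α : H.root) :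
    ∑ i ∈ Finset.range T.order, (ω ^ i)⁻¹ • F (D.perm^[i + 1] α) =
      ω • ∑ i ∈ Finset.range T.order, (ω ^ i)⁻¹ • F (D.perm^[i] α) := by
  have h0 := hω.ne_zero T.order_pos.ne'
  have h1 := Finset.sum_range_succ (fun i => (ω ^ i)⁻¹ • F (D.perm^[i] α)) T.order
  rw [Finset.sum_range_succ', hω.pow_eq_one, pow_zero, D.perm_iterate_order,
    Function.iterate_zero_apply] at h1
  rw [← add_right_cancel h1, Finset.smul_sum]
  refine Finset.sum_congr rfl fun i _ => ?_
  rw [smul_smul, pow_succ, mul_inv, mul_comm, inv_mul_cancel_right₀ h0]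

theorem orbitCoroot_mem (hω : IsPrimitiveRoot ω T.order) (α : H.root) :
    D.orbitCoroot ω α ∈ cartanPart H D.θ ω := by
  refine ⟨Submodule.sum_mem _ fun i _ => Submodule.smul_mem _ _ (SetLike.coe_mem _), ?_⟩
  change D.θ _ = ω ^ 1 • _
  rw [pow_one, orbitCoroot, ← D.sum_range_orbit_succ hω (fun β => ((rootSystem H).coroot β : L)) α,
    map_sum]
  refine Finset.sum_congr rfl fun i _ => ?_
  rw [map_smul, ← coroot_perm, Function.iterate_succ_apply']

theorem root_orbitCoroot (hω : IsPrimitiveRoot ω T.order) (α β : H.root) :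
    restrictRoot H D.θ ω α ⟨D.orbitCoroot ω β, D.orbitCoroot_mem hω β⟩ =
      ∑ i ∈ Finset.range T.order, (ω ^ i)⁻¹ * (rootSystem H).pairing α (D.perm^[i] β) := by
  rw [restrictRoot_apply]
  have : (⟨D.orbitCoroot ω β, (D.orbitCoroot_mem hω β).1⟩ : H) =
      ∑ i ∈ Finset.range T.order, (ω ^ i)⁻¹ • (rootSystem H).coroot (D.perm^[i] β) := by
    apply Subtype.ext
    simp [orbitCoroot]
  rw [this]
  simp only [map_sum, map_smul, smul_eq_mul]
  rfl

/-- The roots that vanish on `𝔠` are the roots fixed by the automorphism. -/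
theorem restrictRoot_eq_zero_iff (hω : IsPrimitiveRoot ω T.order) (α : H.root) :
    restrictRoot H D.θ ω α = 0 ↔ D.perm α = α := by
  have h0 := hω.ne_zero T.order_pos.ne'
  have hone : ω ≠ 1 := hω.ne_one (by rcases T.order_eq with h | h <;> omega)
  constructor
  · intro h
    -- Evaluating on `∑ ω^{-i} θ^i(α^∨)` gives an integral relation between powers of `ω` with
    -- leading coefficient `⟨α, α^∨⟩ = 2`. It forces all the pairings in it to be 2, and pairing 2
    -- both ways means equality.
    have key : (rootSystem H).pairing α (D.perm α) = 2 := by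
      have h1 := D.root_orbitCoroot hω α α
      rw [h, LinearMap.zero_apply] at h1
      have h2 := (rootSystem H).pairing_same α
      rcases T.order_eq with hT | hT
      · rw [hT] at h1 hω
        rw [hω.eq_neg_one_of_two_right] at h1
        simp only [Finset.sum_range_succ, Finset.sum_range_zero, Function.iterate_succ_apply,
          Function.iterate_zero_apply, h2] at h1
        linear_combination (exp := 1) h1
      · rw [hT] at h1 hω
        simp only [Finset.sum_range_succ, Finset.sum_range_zero, Function.iterate_succ_apply,
          Function.iterate_zero_apply, ← (rootSystem H).algebraMap_pairingIn ℤ] at h1 h2 ⊢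
        have e1 : ω⁻¹ = ω ^ 2 := inv_eq_of_mul_eq_one_right (by rw [← pow_succ', hω.pow_eq_one])
        have e2 : (ω ^ 2)⁻¹ = ω := by rw [← e1, inv_inv]
        have h3 : ((rootSystem H).pairingIn ℤ α α : ℂ) +
            (rootSystem H).pairingIn ℤ α (D.perm (D.perm α)) * ω +
            (rootSystem H).pairingIn ℤ α (D.perm α) * ω ^ 2 = 0 := by
          simp only [pow_zero, inv_one, one_mul, pow_one, e1, e2, zero_add,
            algebraMap_int_eq, eq_intCast] at h1
          linear_combination -h1
        obtain ⟨h4, h5⟩ := int_eq_of_cube_root_relation hω h3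
        rw [← h5, ← h4, h2]
    exact ((rootSystem H).pairing_two_two_iff α (D.perm α)).1
      ⟨key, by rw [D.pairing_comm, key]⟩ |>.symm
  · intro h
    have h1 := D.restrictRoot_perm h0 α
    rw [h] at h1
    by_contra hne
    have h2 : (1 - ω⁻¹) • restrictRoot H D.θ ω α = 0 := by
      rw [sub_smul, one_smul, ← h1, sub_self]
    rcases smul_eq_zero.1 h2 with h3 | h3
    · exact hone (by rw [sub_eq_zero] at h3; exact inv_eq_one.1 h3.symm)
    · exact hne h3

end DiagramAutomorphism

namespace DiagramAutomorphism

variable {T : DiagramType} {L : Type*} [LieRing L] [LieAlgebra ℂ L] [FiniteDimensional ℂ L]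
  [IsKilling ℂ L] {H : LieSubalgebra ℂ L} [H.IsCartanSubalgebra] (D : DiagramAutomorphism T H)
  {ω : ℂ}

theorem mem_cartanPart_of_commute (hω : IsPrimitiveRoot ω T.order) {x : L}
    (hx : x ∈ gradedPart D.θ ω 1) (hc : ∀ y ∈ cartanPart H D.θ ω, ⁅y, x⁆ = 0) :
    x ∈ cartanPart H D.θ ω := by
  have hone : ω ≠ 1 := hω.ne_one (by rcases T.order_eq with h | h <;> omega)
  have hx1 : D.θ x = ω • x := by simpa [gradedPart] using hx
  have hind := LieSubmodule.iSupIndep_toSubmodule.mpr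
    (LieModule.iSupIndep_genWeightSpace' ℂ H L)
  have htop : x ∈ ⨆ χ : LieModule.Weight ℂ H L, (rootSpace H χ).toSubmodule := by
    rw [LieSubmodule.iSup_toSubmodule_eq_top.mpr (LieModule.iSup_genWeightSpace_eq_top' ℂ H L)]
    trivial
  classical
  obtain ⟨f, hf⟩ := (Submodule.mem_iSup_iff_exists_dfinsupp _ x).1 htop
  have hsum : ∑ χ, (f χ : L) = x := by
    rw [← hf, DFinsupp.lsum_apply_apply, DFinsupp.sumAddHom_apply,
      DFinsupp.sum_eq_sum_fintype _ fun _ => map_zero _]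
    rfl
  -- Each component of `x` is an eigenvector of `y`, and components in distinct root spaces are
  -- independent; so a component survives only where its weight vanishes on `𝔠`.
  have hvanish (y : L) (hy : y ∈ cartanPart H D.θ ω) (χ : LieModule.Weight ℂ H L) :
      χ ⟨y, hy.1⟩ • (f χ : L) = 0 := by
    have h1 : ∑ χ : LieModule.Weight ℂ H L, χ ⟨y, hy.1⟩ • (f χ : L) = 0 := by
      rw [← hc y hy, ← hsum, lie_sum]
      refine Finset.sum_congr rfl fun χ _ => ?_
      exact (lie_eq_smul_of_mem_rootSpace (f χ).2 ⟨y, hy.1⟩).symm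
    exact (iSupIndep_iff_finsetSum_eq_zero_imp_eq_zero _).1 hind Finset.univ
      (fun χ => χ ⟨y, hy.1⟩ • (f χ : L))
      (fun χ _ => Submodule.smul_mem _ _ (f χ).2) h1 χ (Finset.mem_univ _)
  have hfix (χ : LieModule.Weight ℂ H L) : (f χ : L) ∈ H ∨ D.θ (f χ) = f χ := by
    by_cases hχ : χ.IsZero
    · left
      have h1 := (f χ).2
      have h2 : (χ : H → ℂ) = 0 := hχ
      generalize (f χ : L) = z at h1 ⊢
      rwa [LieSubmodule.mem_toSubmodule, h2, rootSpace_zero_eq] at h1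
    · right
      let α : H.root := ⟨χ, by simpa using hχ⟩
      obtain ⟨t, ht⟩ := D.mem_span_e α (x := f χ) (f χ).2
      by_cases h0 : (f χ : L) = 0
      · rw [h0, map_zero]
      have h1 : restrictRoot H D.θ ω α = 0 := by
        ext y
        exact (smul_eq_zero.1 (hvanish y y.2 χ)).resolve_right h0
      rw [ht, map_smul, map_e_eq, (D.restrictRoot_eq_zero_iff hω α).1 h1]
  have hdec : ∃ a b : L, a ∈ H ∧ D.θ b = b ∧ x = a + b := by
    refine ⟨∑ χ, (if (f χ : L) ∈ H then (f χ : L) else 0),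
      ∑ χ, (if (f χ : L) ∈ H then 0 else (f χ : L)), ?_, ?_, ?_⟩
    · exact sum_mem fun χ _ => by split_ifs with h; exacts [h, H.zero_mem]
    · rw [map_sum]
      refine Finset.sum_congr rfl fun χ _ => ?_
      split_ifs with h
      · exact map_zero _
      · exact (hfix χ).resolve_left h
    · rw [← Finset.sum_add_distrib, ← hsum]
      refine Finset.sum_congr rfl fun χ _ => ?_
      split_ifs <;> simp
  obtain ⟨a, b, ha, hb, hab⟩ := hdec
  -- Comparing `θ x = θ a + b` with `ω x = ω a + ω b` puts `(1 - ω) b`, hence `b`, in `𝔥`.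
  have h1 : (1 - ω) • b = ω • a - D.θ a := by
    rw [hab, map_add, hb, smul_add] at hx1
    rw [sub_smul, one_smul, sub_eq_sub_iff_add_eq_add, add_comm b, hx1]
  have h2 : b ∈ H := by
    have h3 : (1 - ω)⁻¹ • ((1 - ω) • b) ∈ H := by
      rw [h1]
      exact H.smul_mem _ (H.sub_mem (H.smul_mem _ ha) ((D.map_mem_iff a).2 ha))
    rwa [inv_smul_smul₀ (sub_ne_zero.2 hone.symm)] at h3
  exact ⟨hab ▸ H.add_mem ha h2, hx⟩

theorem isCartanSubspace_cartanPart (hω : IsPrimitiveRoot ω T.order) :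
    IsCartanSubspace D.θ ω (cartanPart H D.θ ω) := by
  refine ⟨⟨inf_le_right, fun x hx y hy => ?_, fun x hx => ?_⟩, fun a ha hle x hx => ?_⟩
  · have : ⁅(⟨x, hx.1⟩ : H), (⟨y, hy.1⟩ : H)⁆ = 0 := trivial_lie_zero _ _ _ _
    simpa using congrArg Subtype.val this
  · exact isSemisimple_ad_of_mem_isCartanSubalgebra hx.1
  -- Only commutation with `𝔠` enters, so `𝔠` is maximal even among abelian subspaces of `𝔤_1` with
  -- no semisimplicity condition.
  · exact D.mem_cartanPart_of_commute hω (ha.1 hx) fun y hy => ha.2.1 y (hle hy) x hx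

/-- The roots of the orbit of `α` are pairwise orthogonal. -/
def OrthogonalOrbit (α : H.root) : Prop :=
  ∀ i < T.order, ∀ j < T.order, i ≠ j →
    (rootSystem H).pairing (D.perm^[i] α) (D.perm^[j] α) = 0

/-! ### Reflections from orthogonal orbits -/

variable {D} {α : H.root}

theorem OrthogonalOrbit.pairing (h : D.OrthogonalOrbit α) {i j : ℕ} (hi : i < T.order)
    (hj : j < T.order) :
    (rootSystem H).pairing (D.perm^[i] α) (D.perm^[j] α) = if i = j then 2 else 0 := by
  split_ifs with hij
  · rw [hij, RootPairing.pairing_same]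
  · exact h i hi j hj hij

theorem pairing_negRoot_left (α β : H.root) :
    (rootSystem H).pairing (negRoot α) β = -(rootSystem H).pairing α β := by
  rw [← RootPairing.root_coroot_eq_pairing, root_negRoot]; simp

theorem pairing_negRoot_right (α β : H.root) :
    (rootSystem H).pairing α (negRoot β) = -(rootSystem H).pairing α β := by
  rw [← RootPairing.root_coroot_eq_pairing, coroot_negRoot]; simp

theorem OrthogonalOrbit.negRoot (h : D.OrthogonalOrbit α) : D.OrthogonalOrbit (negRoot α) := by
  intro i hi j hj hij
  rw [perm_iterate_negRoot, perm_iterate_negRoot, pairing_negRoot_left, pairing_negRoot_right,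
    neg_neg, h i hi j hj hij]

/-- Orthogonal roots are distinct, so the orbit has exactly `m` elements and the factor `|O_α| / m`
is 1. -/
theorem OrthogonalOrbit.eComp_zero (h : D.OrthogonalOrbit α) :
    D.eComp ω 0 α = ∑ i ∈ Finset.range T.order, D.e (D.perm^[i] α) := by
  have h0 : (T.order : ℂ) ≠ 0 := by exact_mod_cast T.order_pos.ne'
  have hcard : (thetaOrbit D.θ D.map_mem_iff T.order ((rootSystem H).root α)).ncard = T.order := by
    have h1 : thetaOrbit D.θ D.map_mem_iff T.order ((rootSystem H).root α) =
        (fun i => (rootSystem H).root (D.perm^[i] α)) '' (Finset.range T.order : Set ℕ) := by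
      ext ν
      simp only [thetaOrbit, ← root_perm_iterate]
      constructor
      · rintro ⟨i, hi, rfl⟩; exact ⟨i, by simpa using hi, rfl⟩
      · rintro ⟨i, hi, rfl⟩; exact ⟨i, by simpa using hi, rfl⟩
    rw [h1, Set.InjOn.ncard_image, Set.ncard_coe_finset, Finset.card_range]
    intro i hi j hj hij
    by_contra hne
    have h2 := h i (by simpa using hi) j (by simpa using hj) hne
    rw [(rootSystem H).root.injective hij, RootPairing.pairing_same] at h2
    exact two_ne_zero h2
  rw [eComp, hcard, div_self h0, one_smul]
  exact Finset.sum_congr rfl fun i _ => by simp [iterate_e]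

variable (D α) in
/-- The sum of the root vectors of the orbits of `α` and `-α`. -/
def orbitSum : L :=
  ∑ i ∈ Finset.range T.order, (D.e (D.perm^[i] α) + D.e (negRoot (D.perm^[i] α)))

variable (D ω α) in
/-- The vector `∑ ω^{-i} θ^i (e_α - e_{-α})`. -/
def orbitDiff : L :=
  ∑ i ∈ Finset.range T.order, (ω ^ i)⁻¹ •
    (D.e (D.perm^[i] α) - D.e (negRoot (D.perm^[i] α)))

theorem OrthogonalOrbit.eComp_add_eComp (h : D.OrthogonalOrbit α) :
    D.eComp ω 0 α + D.eComp ω 0 (ThetaGroup.negRoot α) = D.orbitSum α := by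
  rw [h.eComp_zero, h.negRoot.eComp_zero, ← Finset.sum_add_distrib]
  exact Finset.sum_congr rfl fun i _ => by rw [perm_iterate_negRoot]

variable (D) in
theorem lie_sum_e (h : H) (β : H.root) :
    ⁅D.e β + D.e (ThetaGroup.negRoot β), (h : L)⁆ =
      -((rootSystem H).root β h) • (D.e β - D.e (ThetaGroup.negRoot β)) := by
  rw [← lie_skew, lie_add, D.lie_e, D.lie_e, root_negRoot, LinearMap.neg_apply]
  module

variable (D) in
theorem lie_sum_diff_of_orthogonal {β γ : H.root} (h : (rootSystem H).pairing β γ = 0) :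
    ⁅D.e β + D.e (ThetaGroup.negRoot β), D.e γ - D.e (ThetaGroup.negRoot γ)⁆ = 0 := by
  rw [add_lie, lie_sub, lie_sub, D.lie_e_eq_zero h,
    D.lie_e_eq_zero (by rw [pairing_negRoot_right, h, neg_zero]),
    D.lie_e_eq_zero (by rw [pairing_negRoot_left, h, neg_zero]),
    D.lie_e_eq_zero (by rw [pairing_negRoot_left, pairing_negRoot_right, h, neg_zero, neg_zero])]
  simp

variable (D) in
theorem lie_sum_diff_self (β : H.root) :
    ⁅D.e β + D.e (ThetaGroup.negRoot β), D.e β - D.e (ThetaGroup.negRoot β)⁆ =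
      (2 : ℂ) • ((rootSystem H).coroot β : L) := by
  have h1 := D.lie_e_neg β
  have h2 := D.lie_e_neg (ThetaGroup.negRoot β)
  rw [negRoot_negRoot, coroot_negRoot] at h2
  rw [add_lie, lie_sub, lie_sub, h1, h2, lie_self, lie_self]
  simp only [NegMemClass.coe_neg]
  module

/-- Orthogonality kills the cross terms between different members of the orbit; each diagonal term
contributes twice a coroot. -/
theorem OrthogonalOrbit.lie_orbitSum_orbitDiff (h : D.OrthogonalOrbit α) :
    ⁅D.orbitSum α, D.orbitDiff ω α⁆ = (2 : ℂ) • D.orbitCoroot ω α := by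
  rw [orbitSum, orbitDiff, lie_sum]
  rw [orbitCoroot, Finset.smul_sum]
  refine Finset.sum_congr rfl fun j hj => ?_
  rw [lie_smul, sum_lie, Finset.sum_eq_single_of_mem j hj, lie_sum_diff_self, smul_comm]
  intro i hi hij
  exact D.lie_sum_diff_of_orthogonal
    (h i (Finset.mem_range.1 hi) j (Finset.mem_range.1 hj) hij)

theorem lie_orbitSum_of_mem (hω : IsPrimitiveRoot ω T.order) (y : cartanPart H D.θ ω) :
    ⁅D.orbitSum α, (y : L)⁆ = -restrictRoot H D.θ ω α y • D.orbitDiff ω α := by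
  have h0 := hω.ne_zero T.order_pos.ne'
  rw [orbitSum, orbitDiff, sum_lie, Finset.smul_sum]
  refine Finset.sum_congr rfl fun i _ => ?_
  have h1 := LinearMap.congr_fun (D.restrictRoot_perm_iterate h0 α i) y
  rw [restrictRoot_apply, LinearMap.smul_apply, smul_eq_mul] at h1
  rw [D.lie_sum_e ⟨y, y.2.1⟩, h1, smul_smul]
  congr 1
  ring

theorem OrthogonalOrbit.restrictRoot_orbitCoroot (h : D.OrthogonalOrbit α)
    (hω : IsPrimitiveRoot ω T.order) :
    restrictRoot H D.θ ω α ⟨D.orbitCoroot ω α, D.orbitCoroot_mem hω α⟩ = 2 := by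
  rw [root_orbitCoroot D hω, Finset.sum_eq_single_of_mem 0 (Finset.mem_range.2 T.order_pos)]
  · simp only [pow_zero, inv_one, one_mul, Function.iterate_zero_apply, RootPairing.pairing_same]
  · intro i hi hi0
    have := h 0 T.order_pos i (Finset.mem_range.1 hi) hi0.symm
    rw [Function.iterate_zero_apply] at this
    rw [this, mul_zero]

theorem orbitSum_mem_gradedPart_zero : D.orbitSum α ∈ gradedPart D.θ ω 0 := by
  change D.θ _ = ω ^ 0 • _
  rw [pow_zero, one_smul]
  have h1 := Finset.sum_range_succ
    (fun i => D.e (D.perm^[i] α) + D.e (negRoot (D.perm^[i] α))) T.order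
  rw [Finset.sum_range_succ', D.perm_iterate_order, Function.iterate_zero_apply] at h1
  rw [orbitSum]
  conv_rhs => rw [← add_right_cancel h1]
  rw [map_sum]
  refine Finset.sum_congr rfl fun i _ => ?_
  rw [map_add, map_e_eq, map_e_eq, perm_negRoot, Function.iterate_succ_apply' D.perm i α]

/-- The exponential attached to a root with orthogonal orbit acts on `𝔠` as a reflection. -/
theorem OrthogonalOrbit.exists_reflection (h : D.OrthogonalOrbit α)
    (hω : IsPrimitiveRoot ω T.order)
    (V : Type*) [AddCommGroup V] [Module ℂ V] [FiniteDimensional ℂ V]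
    [LieRingModule L V] [LieModule ℂ L V] :
    ∃ s ∈ littleWeylGroup V D.θ ω (cartanPart H D.θ ω),
      IsReflection s ∧ fixedSpace s = LinearMap.ker (restrictRoot H D.θ ω α) ∧
      Lifts V D.θ ω (cartanPart H D.θ ω)
        (expGL (LieModule.toEnd ℂ L V
          (((Real.pi : ℂ) / 2) • (D.eComp ω 0 α + D.eComp ω 0 (ThetaGroup.negRoot α))))) s := by
  set c := cartanPart H D.θ ω
  set r := restrictRoot H D.θ ω α
  let v : c := ⟨D.orbitCoroot ω α, D.orbitCoroot_mem hω α⟩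
  have hrv : r v = 2 := h.restrictRoot_orbitCoroot hω
  have hv : v ≠ 0 := fun h0 => two_ne_zero (α := ℂ) (by rw [← hrv, h0, map_zero])
  let s : c ≃ₗ[ℂ] c := Module.reflection hrv
  have hs (y : c) : s y = y - r y • v := Module.reflection_apply y hrv
  have hfix : fixedSpace s = LinearMap.ker r := by
    ext y
    simp only [fixedSpace, LinearMap.mem_ker, LinearMap.sub_apply, LinearMap.id_apply,
      LinearEquiv.coe_coe, hs, sub_sub_cancel_left, neg_eq_zero, smul_eq_zero, hv, or_false]
  have hlift : Lifts V D.θ ω c (expGL (LieModule.toEnd ℂ L V (((Real.pi : ℂ) / 2) •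
      (D.eComp ω 0 α + D.eComp ω 0 (ThetaGroup.negRoot α))))) s := by
    rw [h.eComp_add_eComp]
    refine ⟨Subgroup.subset_closure ⟨_, Submodule.smul_mem _ _ orbitSum_mem_gradedPart_zero, rfl⟩,
      fun y => ?_⟩
    rw [Units.mul_inv_eq_iff_eq_mul, map_smul]
    set F := LieModule.toEnd ℂ L V (D.orbitSum α) with hF
    have hcomm (a b : L) (hab : ⁅D.orbitSum α, a⁆ = b) :
        F * LieModule.toEnd ℂ L V a - LieModule.toEnd ℂ L V a * F = LieModule.toEnd ℂ L V b := by
      ext m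
      rw [← hab]
      exact (lie_lie _ _ _).symm
    have h1 := expGL_conj_of_rotation (f := F) (z := LieModule.toEnd ℂ L V (v : L))
      (w := LieModule.toEnd ℂ L V (D.orbitDiff ω α))
      (by rw [hcomm v _ rfl, lie_orbitSum_of_mem hω v, map_smul]; rw [← hrv])
      (by rw [hcomm _ _ h.lie_orbitSum_orbitDiff, map_smul])
    -- Splits `y` along `𝔠 = ker r ⊕ ℂ v`; the coefficient is `r y / 2` because `r v = 2`. The
    -- exponential fixes the first part and negates the second.
    let y' : c := y - (r y / 2) • v
    have hry' : r y' = 0 := by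
      simp only [y', map_sub, map_smul, hrv, smul_eq_mul]; ring
    have h2 := expGL_commute (f := F) (z := LieModule.toEnd ℂ L V (y' : L))
      (by
        rw [hcomm y' _ rfl, lie_orbitSum_of_mem hω y']
        change LieModule.toEnd ℂ L V (-r y' • _) = 0
        rw [hry', neg_zero, zero_smul, map_zero]) ((Real.pi : ℂ) / 2)
    have e1 : (y : L) = y' + (r y / 2) • (v : L) := by
      simp [y']
    have e2 : (s y : L) = y' - (r y / 2) • (v : L) := by
      rw [hs]
      simp only [y', Submodule.coe_sub, Submodule.coe_smul]
      module
    rw [e1, e2, map_add, map_sub, map_smul, mul_add, sub_mul, h2, mul_smul_comm, h1,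
      smul_mul_assoc, smul_neg, sub_eq_add_neg]
  refine ⟨s, ⟨_, hlift⟩, ⟨?_, ?_⟩, hfix, hlift⟩
  · refine isOfFinOrder_iff_pow_eq_one.2 ⟨2, two_pos, ?_⟩
    ext y
    rw [pow_two]
    exact congrArg Subtype.val (Module.involutive_reflection hrv y)
  · rw [hfix]
    have hr : r ≠ 0 := fun h0 => two_ne_zero (α := ℂ) (by rw [← hrv, h0, LinearMap.zero_apply])
    exact Module.Dual.finrank_ker_add_one_of_ne_zero hr

end DiagramAutomorphism

/-! ### The table of representatives -/

namespace DiagramAutomorphism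

section

variable {T : DiagramType} {L : Type*} [LieRing L] [LieAlgebra ℂ L] [FiniteDimensional ℂ L]
  [IsKilling ℂ L] {H : LieSubalgebra ℂ L} [H.IsCartanSubalgebra] (D : DiagramAutomorphism T H)
  {ω : ℂ}

theorem orthogonalOrbit_of_order_two (hT : T.order = 2) {α : H.root} (hα : D.perm α ≠ α) :
    D.OrthogonalOrbit α := by
  have h1 := D.pairing_perm_self_eq_zero hT hα
  have h2 : (rootSystem H).pairing (D.perm α) α = 0 := by rw [D.pairing_comm, h1]
  intro i hi j hj hij
  rw [hT] at hi hj
  interval_cases i <;> interval_cases j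
  · exact absurd rfl hij
  · exact h1
  · exact h2
  · exact absurd rfl hij

theorem ker_eq_of_eq_smul {M : Type*} [AddCommGroup M] [Module ℂ M] {f g : Module.Dual ℂ M} {t : ℂ}
    (h : f = t • g) (hf : f ≠ 0) : LinearMap.ker g = LinearMap.ker f := by
  have ht : t ≠ 0 := by rintro rfl; exact hf (by rw [h, zero_smul])
  rw [h, LinearMap.ker_smul _ _ ht]

/-- When the simple roots restrict to a single line of `𝔠^*`, so do all their combinations, and one
table root serves every `σ`. -/
theorem exists_restrictRoot_eq_smul {k : Fin T.rank}
    (h : ∀ i, ∃ t : ℂ, restrictRoot H D.θ ω (D.label i) = t • restrictRoot H D.θ ω (D.label k))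
    (β : H.root) : ∃ t : ℂ, restrictRoot H D.θ ω β = t • restrictRoot H D.θ ω (D.label k) := by
  obtain ⟨f, -, hf⟩ := D.exists_root_eq_sum_label β
  choose t ht using h
  refine ⟨∑ i, (f i : ℂ) * t i, ?_⟩
  rw [D.restrictRoot_eq_sum hf, Finset.sum_smul]
  exact Finset.sum_congr rfl fun i _ => by rw [ht, smul_smul]

theorem root_perm_eq_sum {κ : Type*} {S : Finset κ} {α : H.root} {f : κ → ℂ} {r : κ → H.root}
    (h : (rootSystem H).root α = ∑ k ∈ S, f k • (rootSystem H).root (r k)) :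
    (rootSystem H).root (D.perm α) = ∑ k ∈ S, f k • (rootSystem H).root (D.perm (r k)) := by
  rw [root_perm, ← dualActHom_apply, h, map_sum]
  exact Finset.sum_congr rfl fun k _ => by rw [map_smul, dualActHom_apply, ← root_perm]

theorem exists_root_eq_add_of_pairing_eq_neg_one {α β : H.root}
    (h : (rootSystem H).pairing α β = -1) :
    ∃ γ, (rootSystem H).root γ = (rootSystem H).root α + (rootSystem H).root β := by
  have hp : (rootSystem H).pairingIn ℤ α β = -1 := by
    rw [← (rootSystem H).algebraMap_pairingIn ℤ, algebraMap_int_eq, eq_intCast] at h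
    exact_mod_cast h
  refine (rootSystem H).root_add_root_mem_of_pairingIn_neg (hp ▸ neg_one_lt_zero) fun h' => ?_
  rw [(rootSystem H).root.injective (h'.trans (root_negRoot β).symm), pairing_negRoot_left,
    RootPairing.pairing_same] at h
  norm_num at h

theorem isTableRoot_label {k : Fin T.rank} (h : T.IsTableEntry {k}) : D.IsTableRoot (D.label k) :=
  ⟨{k}, h, by simp⟩

theorem exists_tableRoot_of_label {k : Fin T.rank} (hk : T.IsTableEntry {k})
    (h : ∀ i, ∃ t : ℂ, restrictRoot H D.θ ω (D.label i) = t • restrictRoot H D.θ ω (D.label k))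
    {β : H.root} (hβ : restrictRoot H D.θ ω β ≠ 0) :
    ∃ α : H.root, D.IsTableRoot α ∧
      LinearMap.ker (restrictRoot H D.θ ω α) = LinearMap.ker (restrictRoot H D.θ ω β) := by
  obtain ⟨t, ht⟩ := D.exists_restrictRoot_eq_smul h β
  exact ⟨D.label k, D.isTableRoot_label hk, ker_eq_of_eq_smul ht hβ⟩

end

variable {L : Type*} [LieRing L] [LieAlgebra ℂ L] [FiniteDimensional ℂ L]
  [IsKilling ℂ L] {H : LieSubalgebra ℂ L} [H.IsCartanSubalgebra] {ω : ℂ}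

/-! ### The orthogonal families: one line of restricted roots -/

theorem exists_tableRoot_so {n : ℕ} {hn : 2 ≤ n} (D : DiagramAutomorphism (.so n hn) H)
    (hω : IsPrimitiveRoot ω (DiagramType.so n hn).order) {β : H.root}
    (hβ : restrictRoot H D.θ ω β ≠ 0) :
    ∃ α : H.root, D.IsTableRoot α ∧
      LinearMap.ker (restrictRoot H D.θ ω α) = LinearMap.ker (restrictRoot H D.θ ω β) := by
  have h0 := hω.ne_zero (DiagramType.order_pos _).ne'
  refine D.exists_tableRoot_of_label (k := Fin.last n) rfl (fun i => ?_) hβ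
  by_cases h1 : i = Fin.last n
  · exact ⟨1, by rw [h1, one_smul]⟩
  · have h2 := D.perm_label i
    by_cases h3 : i = (⟨n - 1, by omega⟩ : Fin (n + 1))
    · have h4 : (DiagramType.so n hn).symmetry i = Fin.last n := by
        rw [h3]; exact Equiv.swap_apply_left _ _
      refine ⟨ω, ?_⟩
      rw [← h4, ← h2, D.restrictRoot_perm h0, smul_smul, mul_inv_cancel₀ h0, one_smul]
    · have h4 : (DiagramType.so n hn).symmetry i = i :=
        Equiv.swap_apply_of_ne_of_ne h3 h1
      refine ⟨0, ?_⟩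
      rw [zero_smul, D.restrictRoot_eq_zero_iff hω, h2, h4]

theorem exists_tableRoot_so8 (D : DiagramAutomorphism .so8 H)
    (hω : IsPrimitiveRoot ω DiagramType.so8.order) {β : H.root}
    (hβ : restrictRoot H D.θ ω β ≠ 0) :
    ∃ α : H.root, D.IsTableRoot α ∧
      LinearMap.ker (restrictRoot H D.θ ω α) = LinearMap.ker (restrictRoot H D.θ ω β) := by
  have h0 := hω.ne_zero (DiagramType.order_pos _).ne'
  obtain ⟨k, hk, hsymm⟩ : ∃ k, DiagramType.so8.IsTableEntry {k} ∧ ∀ i,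
      (∃ j, i = DiagramType.so8.symmetry^[j] k) ∨ DiagramType.so8.symmetry i = i := by
    refine ⟨(0 : Fin 4), rfl, fun i => ?_⟩
    change Fin 4 at i
    fin_cases i
    exacts [.inl ⟨0, rfl⟩, .inr rfl, .inl ⟨1, rfl⟩, .inl ⟨2, rfl⟩]
  refine D.exists_tableRoot_of_label hk (fun i => ?_) hβ
  rcases hsymm i with ⟨j, rfl⟩ | h1
  · exact ⟨_, by rw [← D.perm_iterate_label, D.restrictRoot_perm_iterate h0]⟩
  · exact ⟨0, by rw [zero_smul, D.restrictRoot_eq_zero_iff hω, D.perm_label, h1]⟩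

/-- The orbit of `α_1` consists of the three outer nodes of `D_4`, no two of which are joined. -/
theorem orthogonalOrbit_so8 (D : DiagramAutomorphism .so8 H) {α : H.root} (hα : D.IsTableRoot α) :
    D.OrthogonalOrbit α := by
  obtain ⟨k, hk, horth⟩ : ∃ k, (∀ S, DiagramType.so8.IsTableEntry S → S = {k}) ∧
      ∀ i < 3, ∀ j < 3, i ≠ j → DiagramType.so8.cartanMatrix
        (DiagramType.so8.symmetry^[i] k) (DiagramType.so8.symmetry^[j] k) = 0 :=
    ⟨(0 : Fin 4), fun S hS => hS, by decide⟩
  obtain ⟨S, hS, h⟩ := hα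
  rw [hk S hS, Finset.sum_singleton] at h
  intro i hi j hj hij
  rw [(rootSystem H).root.injective h, perm_iterate_label, perm_iterate_label, pairing_label,
    horth i hi j hj hij, Int.cast_zero]

/-! #### Type `A` -/

section TypeA

variable {n : ℕ} {hn : 2 ≤ n} (D : DiagramAutomorphism (.sl n hn) H)

theorem cartanMatrix_A_apply (m : ℕ) (i j : Fin m) : CartanMatrix.A m i j =
    if i.val = j.val then 2 else if i.val + 1 = j.val ∨ j.val + 1 = i.val then -1 else 0 := by
  simp only [CartanMatrix.A, Matrix.of_apply, Fin.ext_iff]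

theorem cartanMatrix_sl_apply (i j : Fin (DiagramType.sl n hn).rank) :
    (DiagramType.sl n hn).cartanMatrix i j =
      if i.val = j.val then 2 else if i.val + 1 = j.val ∨ j.val + 1 = i.val then -1 else 0 :=
  cartanMatrix_A_apply _ i j

/-- The vectors `ε_i`, up to a common translation: `-(α_1 + ⋯ + α_i)`. -/
def epsilon (i : ℕ) : Module.Dual ℂ H :=
  -∑ l : Fin (DiagramType.sl n hn).rank, if l.val < i then (rootSystem H).root (D.label l) else 0

theorem epsilon_sub {i j : ℕ} (hij : i ≤ j) : D.epsilon i - D.epsilon j =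
    ∑ l : Fin (DiagramType.sl n hn).rank with i ≤ l.val ∧ l.val < j,
      (rootSystem H).root (D.label l) := by
  rw [epsilon, epsilon, neg_sub_neg, ← Finset.sum_sub_distrib, Finset.sum_filter]
  refine Finset.sum_congr rfl fun l _ => ?_
  split_ifs <;> first | omega | simp

theorem epsilon_succ (k : Fin (DiagramType.sl n hn).rank) :
    D.epsilon (k.val + 1) = D.epsilon k.val - (rootSystem H).root (D.label k) := by
  have h := D.epsilon_sub (Nat.le_succ k.val)
  have h1 : (Finset.univ.filter fun l : Fin (DiagramType.sl n hn).rank =>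
      k.val ≤ l.val ∧ l.val < k.val + 1) =
      {k} := by
    ext l; simp only [Finset.mem_filter, Finset.mem_univ, true_and, Finset.mem_singleton]; omega
  rw [Nat.succ_eq_add_one, h1, Finset.sum_singleton] at h
  rw [← h, sub_sub_cancel]

/-- The last indicator reflects the normalization `epsilon 0 = 0`, that is, the translation by the
first `ε`; it cancels in differences. -/
theorem epsilon_coroot (k : Fin (DiagramType.sl n hn).rank) {i : ℕ} (hi : i ≤ 2 * n - 1) :
    D.epsilon i ((rootSystem H).coroot (D.label k)) =
      (((if i = k.val then 1 else 0) - (if i = k.val + 1 then 1 else 0) -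
        (if k.val = 0 then 1 else 0) : ℤ) : ℂ) := by
  have hk : k.val < 2 * n - 1 := k.isLt
  induction i with
  | zero => simp [epsilon, eq_comm]
  | succ i ih =>
    have h1 : (rootSystem H).root (D.label ⟨i, hi⟩) ((rootSystem H).coroot (D.label k)) = _ :=
      D.pairing_label ⟨i, hi⟩ k
    rw [D.epsilon_succ ⟨i, hi⟩, LinearMap.sub_apply, ih (by omega), h1, ← Int.cast_sub,
      Int.cast_inj]
    rw [cartanMatrix_sl_apply]
    change _ - (if i = k.val then (2 : ℤ)
      else if i + 1 = k.val ∨ k.val + 1 = i then -1 else 0) = _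
    split_ifs <;> omega

theorem epsilon_swap (k : Fin (DiagramType.sl n hn).rank) (i : ℕ) :
    D.epsilon (Equiv.swap k.val (k.val + 1) i) = D.epsilon i -
      (((if i = k.val then 1 else 0) - (if i = k.val + 1 then 1 else 0) : ℤ) : ℂ) •
        (rootSystem H).root (D.label k) := by
  by_cases h1 : i = k.val
  · rw [h1, Equiv.swap_apply_left, epsilon_succ]; simp
  · by_cases h2 : i = k.val + 1
    · rw [h2, Equiv.swap_apply_right, epsilon_succ]; simp
    · rw [Equiv.swap_apply_of_ne_of_ne h1 h2]; simp [h1, h2]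

/-- Simple roots are differences of consecutive `epsilon`s, and a simple reflection acts on
differences by a transposition of indices, so the shape survives the induction. -/
theorem exists_root_eq_epsilon_sub (β : H.root) : ∃ i j, i ≤ 2 * n - 1 ∧ j ≤ 2 * n - 1 ∧
    (rootSystem H).root β = D.epsilon i - D.epsilon j := by
  induction β using D.base.induction_reflect with
  | h₀ β hβ =>
    obtain ⟨i, j, hi, hj, h⟩ := hβ
    refine ⟨j, i, hj, hi, ?_⟩
    rw [RootPairing.root_reflectionPerm, RootPairing.reflection_apply_self, h, neg_sub]
  | h₁ β hβ =>
    obtain ⟨k, hk⟩ := D.label.surjective ⟨β, hβ⟩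
    have hk' : k.val < 2 * n - 1 := k.isLt
    refine ⟨k.val, k.val + 1, by omega, by omega, ?_⟩
    rw [epsilon_succ, sub_sub_cancel, hk]
  | h₂ β γ hβ hγ =>
    obtain ⟨i, j, hi, hj, h⟩ := hβ
    obtain ⟨k, hk⟩ := D.label.surjective ⟨γ, hγ⟩
    have hk' : k.val < 2 * n - 1 := k.isLt
    have hγ' : γ = D.label k := by rw [hk]
    have hle {i : ℕ} (hi : i ≤ 2 * n - 1) : Equiv.swap k.val (k.val + 1) i ≤ 2 * n - 1 := by
      rw [Equiv.swap_apply_def]; split_ifs <;> omega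
    refine ⟨_, _, hle hi, hle hj, ?_⟩
    rw [epsilon_swap, epsilon_swap, RootPairing.root_reflectionPerm, RootPairing.reflection_apply,
      h, hγ']
    change _ - (D.epsilon i - D.epsilon j) ((rootSystem H).coroot (D.label k)) • _ = _
    rw [LinearMap.sub_apply, D.epsilon_coroot k hi, D.epsilon_coroot k hj]
    push_cast
    module

theorem isTableRoot_of_root_eq_epsilon_sub (hω : IsPrimitiveRoot ω (DiagramType.sl n hn).order)
    {β : H.root} (hβ : restrictRoot H D.θ ω β ≠ 0) {i j : ℕ} (hij : i < j) (hj : j ≤ 2 * n - 1)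
    (h : (rootSystem H).root β = D.epsilon i - D.epsilon j) : D.IsTableRoot β := by
  rw [D.epsilon_sub hij.le] at h
  refine ⟨Finset.univ.filter fun l : Fin (DiagramType.sl n hn).rank => i ≤ l.val ∧ l.val < j,
    -- Indices of `epsilon` start at 0, those of the table at 1. In the excluded case `i + j + 2 =
    -- 2n + 1` the interval of simple roots is stable under reversal, so `θ` fixes the root and its
    -- restriction vanishes.
    ⟨i + 1, j + 1, by omega, by omega, by omega, fun hsum => hβ ?_, fun k => ?_⟩, h⟩
  · rw [D.restrictRoot_eq_zero_iff hω]
    apply (rootSystem H).root.injective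
    have h1 := D.root_perm_eq_sum (f := fun _ => 1) (r := fun l => D.label l)
      (h.trans (Finset.sum_congr rfl fun l _ => (one_smul ℂ _).symm))
    rw [h1, h]
    refine Finset.sum_equiv Fin.revPerm (fun l => ?_) fun l _ => ?_
    · have hl : l.val < 2 * n - 1 := l.isLt
      have hrank : (DiagramType.sl n hn).rank = 2 * n - 1 := rfl
      simp only [Finset.mem_filter, Finset.mem_univ, true_and, Fin.revPerm_apply, Fin.val_rev]
      omega
    · rw [one_smul, perm_label]; rfl
  · simp only [Finset.mem_filter, Finset.mem_univ, true_and]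
    omega

theorem exists_tableRoot_sl (hω : IsPrimitiveRoot ω (DiagramType.sl n hn).order) {β : H.root}
    (hβ : restrictRoot H D.θ ω β ≠ 0) :
    ∃ α : H.root, D.IsTableRoot α ∧
      LinearMap.ker (restrictRoot H D.θ ω α) = LinearMap.ker (restrictRoot H D.θ ω β) := by
  obtain ⟨i, j, hi, hj, h⟩ := D.exists_root_eq_epsilon_sub β
  rcases lt_trichotomy i j with hij | hij | hij
  · exact ⟨β, D.isTableRoot_of_root_eq_epsilon_sub hω hβ hij hj h, rfl⟩
  · exact absurd (by rw [h, hij, sub_self]) ((rootSystem H).ne_zero β)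
  · have h1 := D.restrictRoot_negRoot (ω := ω) β
    refine ⟨negRoot β, D.isTableRoot_of_root_eq_epsilon_sub hω ?_ hij hi ?_, ?_⟩
    · rw [h1]; exact neg_ne_zero.2 hβ
    · rw [root_negRoot, h, neg_sub]
    · rw [h1, LinearMap.ker_neg]

end TypeA

/-! #### Type `E₆` -/

/-- For `β` with coefficients `f`, orthogonal to `θ·β`, the difference `β - θ·β` has squared length
4. It equals `u (α_1 - α_5) + v (α_2 - α_4)` with `u = f 0 - f 4` and `v = f 1 - f 3`, of squared
length `4 (u² + v² - uv)`. -/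
theorem e6_form (f : Fin 6 → ℤ)
    (h1 : 2 = ∑ k : Fin 6, ∑ l : Fin 6, f k * f l * DiagramType.e6.cartanMatrix k l)
    (h2 : 0 = ∑ k : Fin 6, ∑ l : Fin 6,
      f k * f (DiagramType.e6.symmetry l) * DiagramType.e6.cartanMatrix k l) :
    (f 0 - f 4) ^ 2 + (f 1 - f 3) ^ 2 - (f 0 - f 4) * (f 1 - f 3) = 1 := by
  have hA (k l : Fin 6) : DiagramType.e6.cartanMatrix k l =
      (![![2, -1, 0, 0, 0, 0], ![-1, 2, -1, 0, 0, 0], ![0, -1, 2, -1, 0, -1],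
        ![0, 0, -1, 2, -1, 0], ![0, 0, 0, -1, 2, 0], ![0, 0, -1, 0, 0, 2]] :
          Fin 6 → Fin 6 → ℤ) k l := by
    fin_cases k <;> fin_cases l <;> rfl
  have hS (k : Fin 6) : DiagramType.e6.symmetry k = (![4, 3, 2, 1, 0, 5] : Fin 6 → Fin 6) k := rfl
  simp only [hA, hS] at h1 h2
  simp [Fin.sum_univ_six] at h1 h2
  linarith

theorem exists_restrictRoot_e6 (D : DiagramAutomorphism .e6 H)
    (hω : IsPrimitiveRoot ω DiagramType.e6.order) (β : H.root) : ∃ u v : ℤ,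
      restrictRoot H D.θ ω β = (u : ℂ) • restrictRoot H D.θ ω (D.label (0 : Fin 6)) +
        (v : ℂ) • restrictRoot H D.θ ω (D.label (1 : Fin 6)) ∧
      (D.perm β ≠ β → u ^ 2 + v ^ 2 - u * v = 1) := by
  obtain ⟨f, -, hf⟩ := D.exists_root_eq_sum_label β
  have hω' : ω = -1 := IsPrimitiveRoot.eq_neg_one_of_two_right hω
  have hr (i : Fin DiagramType.e6.rank) : restrictRoot H D.θ ω (D.label (DiagramType.e6.symmetry i)) =
      -restrictRoot H D.θ ω (D.label i) := by
    rw [← D.perm_label, D.restrictRoot_perm (hω.ne_zero (DiagramType.order_pos _).ne'), hω']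
    norm_num
  have hfix (i : Fin DiagramType.e6.rank) (hi : DiagramType.e6.symmetry i = i) :
      restrictRoot H D.θ ω (D.label i) = 0 := by
    rw [D.restrictRoot_eq_zero_iff hω, D.perm_label, hi]
  have h4 : restrictRoot H D.θ ω (D.label (4 : Fin 6)) = _ := hr (0 : Fin 6)
  have h3 : restrictRoot H D.θ ω (D.label (3 : Fin 6)) = _ := hr (1 : Fin 6)
  refine ⟨f (0 : Fin 6) - f (4 : Fin 6), f (1 : Fin 6) - f (3 : Fin 6), ?_, fun hβ => ?_⟩
  · rw [D.restrictRoot_eq_sum hf]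
    refine (Fin.sum_univ_six _).trans ?_
    rw [h3, h4, hfix (2 : Fin 6) rfl, hfix (5 : Fin 6) rfl]
    push_cast
    module
  · have hperm : (rootSystem H).root (D.perm β) =
        ∑ i, ((f (DiagramType.e6.symmetry i) : ℤ) : ℂ) • (rootSystem H).root (D.label i) := by
      rw [D.root_perm_eq_sum hf]
      refine Finset.sum_bij' (fun i _ => DiagramType.e6.symmetry i)
        (fun i _ => DiagramType.e6.symmetry i) (by simp) (by simp)
        (fun i _ => DiagramType.e6.symmetry_iterate_order i)
        (fun i _ => DiagramType.e6.symmetry_iterate_order i) fun i _ => ?_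
      rw [D.perm_label]
      rw [show DiagramType.e6.symmetry (DiagramType.e6.symmetry i) = i from
        DiagramType.e6.symmetry_iterate_order i]
    have p1 := pairing_sum_sum D.base D.base_cartanMatrix_symm _ _ _ hf hf
    have p2 := pairing_sum_sum D.base D.base_cartanMatrix_symm _ _ _ hf hperm
    rw [RootPairing.pairing_same] at p1
    rw [D.pairing_perm_self_eq_zero rfl hβ] at p2
    simp only [D.pairing_label] at p1 p2
    exact e6_form f (by exact_mod_cast p1) (by exact_mod_cast p2)

/-- Since `4 (u² + v² - uv) = (u - 2v)² + 3u²`, both integers lie in `{-1, 0, 1}`. -/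
theorem eq_zero_or_eq_of_int_form_eq_one {u v : ℤ} (h : u ^ 2 + v ^ 2 - u * v = 1) :
    u = 0 ∨ v = 0 ∨ u = v := by
  have h1 : u ≤ 1 := by nlinarith [sq_nonneg (u - 2 * v)]
  have h2 : -1 ≤ u := by nlinarith [sq_nonneg (u - 2 * v)]
  have h3 : v ≤ 1 := by nlinarith [sq_nonneg (v - 2 * u)]
  have h4 : -1 ≤ v := by nlinarith [sq_nonneg (v - 2 * u)]
  interval_cases u <;> interval_cases v <;> simp_all

theorem exists_tableRoot_e6 (D : DiagramAutomorphism .e6 H)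
    (hω : IsPrimitiveRoot ω DiagramType.e6.order) {β : H.root}
    (hβ : restrictRoot H D.θ ω β ≠ 0) :
    ∃ α : H.root, D.IsTableRoot α ∧
      LinearMap.ker (restrictRoot H D.θ ω α) = LinearMap.ker (restrictRoot H D.θ ω β) := by
  obtain ⟨u, v, huv, hnorm⟩ := D.exists_restrictRoot_e6 hω β
  have hne : D.perm β ≠ β := fun h => hβ ((D.restrictRoot_eq_zero_iff hω β).2 h)
  rcases eq_zero_or_eq_of_int_form_eq_one (hnorm hne) with rfl | rfl | rfl
  · refine ⟨_, D.isTableRoot_label (k := (1 : Fin 6))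
      ⟨2, 3, by omega, by omega, by omega, by omega, by decide⟩,
      ker_eq_of_eq_smul (t := v) ?_ hβ⟩
    rw [huv]; simp
  · refine ⟨_, D.isTableRoot_label (k := (0 : Fin 6))
      ⟨1, 2, by omega, by omega, by omega, by omega, by decide⟩,
      ker_eq_of_eq_smul (t := u) ?_ hβ⟩
    rw [huv]; simp
  -- Equal coordinates: the restriction is a multiple of that of `α_1 + α_2 = ε_1 - ε_3`, a root
  -- because the two nodes are joined.
  · obtain ⟨γ, hγ⟩ := exists_root_eq_add_of_pairing_eq_neg_one
      ((D.pairing_label (0 : Fin 6) (1 : Fin 6)).trans (by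
        rw [show DiagramType.e6.cartanMatrix (0 : Fin 6) (1 : Fin 6) = -1 by decide]; norm_num))
    have hγ' : restrictRoot H D.θ ω γ = restrictRoot H D.θ ω (D.label (0 : Fin 6)) +
        restrictRoot H D.θ ω (D.label (1 : Fin 6)) := by
      rw [restrictRoot, hγ]; rfl
    refine ⟨γ, ⟨({0, 1} : Finset (Fin 6)),
      ⟨1, 3, by omega, by omega, by omega, by omega,
        show ∀ k : Fin 6, k ∈ ({0, 1} : Finset (Fin 6)) ↔ _ by decide⟩, ?_⟩,
      ker_eq_of_eq_smul (t := u) ?_ hβ⟩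
    · rw [hγ]; exact (Finset.sum_pair (f := fun k : Fin 6 => (rootSystem H).root (D.label k))
        (show (0 : Fin 6) ≠ 1 by decide)).symm
    · rw [huv, hγ', smul_add]

variable {T : DiagramType}

theorem exists_tableRoot (D : DiagramAutomorphism T H) (hω : IsPrimitiveRoot ω T.order)
    {β : H.root} (hβ : restrictRoot H D.θ ω β ≠ 0) :
    ∃ α : H.root, D.IsTableRoot α ∧
      LinearMap.ker (restrictRoot H D.θ ω α) = LinearMap.ker (restrictRoot H D.θ ω β) := by
  cases T with
  | so n hn => exact D.exists_tableRoot_so hω hβ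
  | sl n hn => exact D.exists_tableRoot_sl hω hβ
  | e6 => exact D.exists_tableRoot_e6 hω hβ
  | so8 => exact D.exists_tableRoot_so8 hω hβ

theorem orthogonalOrbit_of_isTableRoot (D : DiagramAutomorphism T H) {α : H.root}
    (hα : D.IsTableRoot α) (hfix : D.perm α ≠ α) : D.OrthogonalOrbit α := by
  cases T with
  | so n hn => exact D.orthogonalOrbit_of_order_two rfl hfix
  | sl n hn => exact D.orthogonalOrbit_of_order_two rfl hfix
  | e6 => exact D.orthogonalOrbit_of_order_two rfl hfix
  | so8 => exact D.orthogonalOrbit_so8 hα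

end DiagramAutomorphism

end ThetaGroup

end

theorem mainTheorem4 {L : Type*} [LieRing L] [LieAlgebra ℂ L] [FiniteDimensional ℂ L]
    [LieAlgebra.IsSimple ℂ L] (H : LieSubalgebra ℂ L) [H.IsCartanSubalgebra]
    (T : DiagramType) (D : DiagramAutomorphism T H)
    (ω : ℂ) (hω : IsPrimitiveRoot ω T.order)
    (V : Type*) [AddCommGroup V] [Module ℂ V] [FiniteDimensional ℂ V]
    [LieRingModule L V] [LieModule ℂ L V] [LieModule.IsFaithful ℂ L V] :
    IsCartanSubspace D.θ ω (cartanPart H D.θ ω) ∧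
    ∀ σ ∈ restrictedRoots H D.θ ω,
      (∃ α : H.root, D.IsTableRoot α ∧
        LinearMap.ker (restrictRoot H D.θ ω α) = LinearMap.ker σ) ∧
      ∀ α : H.root, D.IsTableRoot α →
        LinearMap.ker (restrictRoot H D.θ ω α) = LinearMap.ker σ →
        ∃ s ∈ littleWeylGroup V D.θ ω (cartanPart H D.θ ω),
          IsReflection s ∧ fixedSpace s = LinearMap.ker σ ∧
          Lifts V D.θ ω (cartanPart H D.θ ω)
            (expGL (LieModule.toEnd ℂ L V
              (((Real.pi : ℂ) / 2) • (D.eComp ω 0 α + D.eComp ω 0 (negRoot α))))) s := by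
  refine ⟨D.isCartanSubspace_cartanPart hω, ?_⟩
  rintro _ ⟨⟨β, rfl⟩, hβ⟩
  refine ⟨D.exists_tableRoot hω hβ, fun α hα hker => ?_⟩
  -- A root fixed by `θ` restricts to 0, and its kernel would be all of `𝔠`, contrary to `σ ≠ 0`.
  have hfix : D.perm α ≠ α := fun h => hβ (by
    rw [(D.restrictRoot_eq_zero_iff hω α).2 h, LinearMap.ker_zero] at hker
    exact LinearMap.ker_eq_top.1 hker.symm)
  rw [← hker]
  exact (D.orthogonalOrbit_of_isTableRoot hα hfix).exists_reflection hω V
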